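/- Let $X$ be a compact connected translation surface with underlying space $S$ and a non-empty finite set $\Sigma$ of cone points and marked points. An affine automorphism of $X$ is a homeomorphism of $S$ that preserves $\Sigma$ and is, in translation charts, locally of the form $z\mapsto Az+c$ with linear part $A\in SL(2,\mathbb R)$ not depending on the chart; the linear parts of all affine automorphisms form the Veech group of $X$ (the same definitions apply to non-compact translation surfaces). Let $G$ be a torsion-free subgroup of finite index of the group of affine automorphisms of $X$ (the full group, if it is torsion-free), and let $\Gamma\subset SL(2,\mathbb R)$ be the group of linear parts of its elements. $G$ acts on $H^1(S,\mathbb R)$, and for a $G$-invariant subspace $V$ we write $\rho_V$ for the action of $G$ on $V$. A subspace is integer if it is spanned by classes coming from $H^1(S,\mathbb Z)$. A discrete subgroup of $SL(2,\mathbb R)$ is of the first kind if its limit set in $\mathbb R\cup\{\infty\}$ is everything, and of the second kind if it is non-elementary (infinite limit set) and its limit set is not everything. Let $F^{(1)},\dots,F^{(n)}\subset H^1(S,\mathbb R)$ be integer $G$-invariant subspaces in direct sum, $F=\bigoplus_j F^{(j)}$ (for example, subspaces of the space $\ker\mathrm{hol}$ of zero-drift classes), and let $K_j=\ker\rho_{F^{(j)}}$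 and $K=\ker\rho_F$. Let $\mathbf f=(f_1,\dots,f_d)$ be linearly independent classes in $H^1(S,\mathbb Z)$ whose images in $H^1(S,\mathbb R)$ lie in $F$, and let $X_{\mathbf f}$ be the $\mathbb Z^d$-cover of $X$ that they define, i.e. the connected covering corresponding to $\bigcap_i\ker(f_i:\pi_1(S)\to\mathbb Z)$, with the pulled-back translation structure, whose singular and marked points are the preimages of those of $X$. Suppose that every $K_j$ is non-trivial. Then $K=\bigcap_j K_j$. Moreover, if $\Gamma$ is of the first kind (resp. of the second kind), then (the group of linear parts of) $K$ is of the first kind (resp. of the second kind), and so is the Veech group of $X_{\mathbf f}$. -/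

import Mathlib

open Set Topology Filter
open scoped MatrixGroups UpperHalfPlane unitInterval

noncomputable section

/-! ### First singular cohomology, through the explicit singular cochain complex -/

/-- The affine edge from the `i`-th to the `j`-th vertex of the standard `2`-simplex. -/
def simplexEdge (i j : Fin 3) : C(I, stdSimplex ℝ (Fin 3)) where
  toFun t := ⟨(1 - (t : ℝ)) • Pi.single i (1 : ℝ) + (t : ℝ) • Pi.single j (1 : ℝ),
    convex_stdSimplex ℝ (Fin 3) (single_mem_stdSimplex ℝ i) (single_mem_stdSimplex ℝ j)
      (by linarith [t.2.2]) t.2.1 (by ring)⟩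
  continuous_toFun := by fun_prop

/-- Singular `1`-cocycles of `S` with coefficients in `R`: functions on singular `1`-simplices
(paths) that vanish on the boundary of every singular `2`-simplex. -/
def singularCocycles (R : Type*) [CommRing R] (S : Type*) [TopologicalSpace S] :
    Submodule R (C(I, S) → R) where
  carrier := {c | ∀ s : C(stdSimplex ℝ (Fin 3), S),
    c (s.comp (simplexEdge 1 2)) - c (s.comp (simplexEdge 0 2))
      + c (s.comp (simplexEdge 0 1)) = 0}
  zero_mem' := by intro s; simp
  add_mem' := by
    intro a b ha hb s
    have h1 := ha s
    have h2 := hb s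
    simp only [Pi.add_apply]
    linear_combination h1 + h2
  smul_mem' := by
    intro r a ha s
    have h1 := ha s
    simp only [Pi.smul_apply, smul_eq_mul]
    linear_combination r * h1

/-- The singular coboundary of a `0`-cochain. -/
def singularCoboundary (R : Type*) [CommRing R] (S : Type*) [TopologicalSpace S] :
    (S → R) →ₗ[R] (C(I, S) → R) where
  toFun b γ := b (γ 1) - b (γ 0)
  map_add' a b := by ext γ; simp only [Pi.add_apply]; ring
  map_smul' r a := by ext γ; simp only [Pi.smul_apply, smul_eq_mul, RingHom.id_apply]; ring

/-- The first singular cohomology `H¹(S, R)`: singular `1`-cocycles modulo coboundaries. -/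
abbrev SingularH1 (R : Type*) [CommRing R] (S : Type*) [TopologicalSpace S] : Type _ :=
  singularCocycles R S ⧸
    (LinearMap.range (singularCoboundary R S)).comap (singularCocycles R S).subtype

namespace SingularH1

variable {R : Type*} [CommRing R] {S T U : Type*}
  [TopologicalSpace S] [TopologicalSpace T] [TopologicalSpace U]

/-- The value of a cohomology class on (the homology class of) a loop. -/
def period (R : Type*) [CommRing R] (γ : C(I, S)) (hγ : γ 0 = γ 1) : SingularH1 R S →ₗ[R] R :=
  Submodule.liftQ _ ((LinearMap.proj γ).comp (singularCocycles R S).subtype) (by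
    rintro ⟨c, hc⟩ ⟨b, hb⟩
    have : c = singularCoboundary R S b := hb.symm
    subst this
    simp [singularCoboundary, hγ])

/-- Pullback of singular cocycles by a continuous map. -/
def cocycleMap (h : C(S, T)) : singularCocycles R T →ₗ[R] singularCocycles R S where
  toFun c := ⟨fun γ => c.1 (h.comp γ), fun s => c.2 (h.comp s)⟩
  map_add' _ _ := rfl
  map_smul' _ _ := rfl

/-- Pullback in cohomology by a continuous map. -/
def map (h : C(S, T)) : SingularH1 R T →ₗ[R] SingularH1 R S :=
  Submodule.mapQ _ _ (cocycleMap h) (by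
    rintro ⟨c, hc⟩ ⟨b, hb⟩
    have : c = singularCoboundary R T b := hb.symm
    subst this
    exact ⟨b ∘ h, rfl⟩)

theorem map_id : map (R := R) (ContinuousMap.id S) = LinearMap.id := by
  refine LinearMap.ext fun x => ?_
  obtain ⟨c, rfl⟩ := Submodule.Quotient.mk_surjective _ x
  rfl

theorem map_comp (h : C(T, U)) (k : C(S, T)) :
    map (R := R) (h.comp k) = (map k).comp (map h) := by
  refine LinearMap.ext fun x => ?_
  obtain ⟨c, rfl⟩ := Submodule.Quotient.mk_surjective _ x
  rfl

/-- Extension of coefficients on cocycles, from `ℤ` to `ℝ`. -/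
def cocycleToReal : singularCocycles ℤ S →ₗ[ℤ] singularCocycles ℝ S where
  toFun c := ⟨fun γ => (c.1 γ : ℝ), fun s => by
    have h := congrArg (Int.cast : ℤ → ℝ) (c.2 s)
    push_cast at h
    exact h⟩
  map_add' a b := by ext γ; simp
  map_smul' n a := by ext γ; simp

/-- Extension of coefficients `H¹(S, ℤ) → H¹(S, ℝ)`. -/
def toReal : SingularH1 ℤ S →ₗ[ℤ] SingularH1 ℝ S :=
  Submodule.liftQ _ ((Submodule.mkQ ((LinearMap.range (singularCoboundary ℝ S)).comap
      (singularCocycles ℝ S).subtype)).restrictScalars ℤ ∘ₗ cocycleToReal) (by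
    rintro ⟨c, hc⟩ ⟨b, hb⟩
    have : c = singularCoboundary ℤ S b := hb.symm
    subst this
    refine (Submodule.Quotient.mk_eq_zero _).2 ⟨fun s => (b s : ℝ), ?_⟩
    ext γ
    simp [singularCoboundary, cocycleToReal])

/-- A real subspace of `H¹(S, ℝ)` is integer (defined over `ℤ`) if it is spanned by
integer classes. -/
def IsInteger (F : Submodule ℝ (SingularH1 ℝ S)) : Prop :=
  Submodule.span ℝ ((F : Set (SingularH1 ℝ S)) ∩ Set.range (toReal (S := S))) = F

end SingularH1

/-! ### Translation surfaces, affine automorphisms, Veech groups -/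

/-- The linear action of `SL(2, ℝ)` on the plane `ℝ² = ℂ`. -/
def planeAct (A : SL(2, ℝ)) (z : ℂ) : ℂ :=
  ⟨A.1 0 0 * z.re + A.1 0 1 * z.im, A.1 1 0 * z.re + A.1 1 1 * z.im⟩

theorem planeAct_one (z : ℂ) : planeAct 1 z = z := by
  apply Complex.ext <;> simp [planeAct]

theorem planeAct_add (A : SL(2, ℝ)) (z w : ℂ) :
    planeAct A (z + w) = planeAct A z + planeAct A w := by
  apply Complex.ext <;> simp [planeAct] <;> ring

theorem planeAct_mul (A B : SL(2, ℝ)) (z : ℂ) :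
    planeAct (A * B) z = planeAct A (planeAct B z) := by
  apply Complex.ext <;> simp [planeAct, Matrix.mul_apply, Fin.sum_univ_two] <;> ring

/-- A translation structure on the space `S` with singular set `sing` (cone points and, possibly,
marked points): an atlas on the complement of `sing` whose transition maps are locally
translations, such that near each point of `sing` there is a coordinate `w`, centred at that
point, in which the translation charts are `w ^ k + const` for some `k ≥ 1`, that is, the
point has cone angle `2πk` (a marked regular point if `k = 1`). -/
structure TranslationSurface (S : Type*) [TopologicalSpace S] where
  /-- singularities and marked points -/
  sing : Set S
  /-- translation charts -/
  charts : Set (OpenPartialHomeomorph S ℂ)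
  disjoint_sing : ∀ φ ∈ charts, Disjoint φ.source sing
  exists_chart : ∀ x, x ∉ sing → ∃ φ ∈ charts, x ∈ φ.source
  translation : ∀ φ ∈ charts, ∀ ψ ∈ charts, ∀ x, x ∈ φ.source → x ∈ ψ.source →
    ∃ c : ℂ, ∀ᶠ y in 𝓝 x, ψ y = φ y + c
  cone : ∀ x ∈ sing, ∃ k : ℕ, 0 < k ∧ ∃ w : OpenPartialHomeomorph S ℂ,
    x ∈ w.source ∧ w x = 0 ∧ w.source ∩ sing = {x} ∧
    ∀ φ ∈ charts, ∀ y, y ∈ w.source → y ∈ φ.source →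
      ∃ c : ℂ, ∀ᶠ z in 𝓝 y, φ z = (w z) ^ k + c

namespace TranslationSurface

variable {S : Type*} [TopologicalSpace S] (X : TranslationSurface S)

/-- `h` is an (orientation- and area-preserving) affine automorphism of `X` with linear part `A`:
a homeomorphism preserving the singular set that is, in translation charts, locally of the form
`z ↦ A z + c`. -/
def IsAffine (h : S ≃ₜ S) (A : SL(2, ℝ)) : Prop :=
  (∀ x, h x ∈ X.sing ↔ x ∈ X.sing) ∧
  ∀ φ ∈ X.charts, ∀ ψ ∈ X.charts, ∀ x, x ∈ φ.source → h x ∈ ψ.source →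
    ∃ c : ℂ, ∀ᶠ y in 𝓝 x, ψ (h y) = planeAct A (φ y) + c

variable {X}

theorem IsAffine.one : X.IsAffine 1 1 := by
  refine ⟨fun x => Iff.rfl, fun φ hφ ψ hψ x hx hx' => ?_⟩
  obtain ⟨c, hc⟩ := X.translation φ hφ ψ hψ x hx hx'
  exact ⟨c, by simpa [planeAct_one] using hc⟩

theorem IsAffine.mul {g h : S ≃ₜ S} {A B : SL(2, ℝ)} (hg : X.IsAffine g A)
    (hh : X.IsAffine h B) : X.IsAffine (g * h) (A * B) := by
  refine ⟨fun x => (hg.1 (h x)).trans (hh.1 x), fun φ hφ ψ hψ x hx hx' => ?_⟩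
  have hxs : x ∉ X.sing := fun hs => (X.disjoint_sing φ hφ).le_bot ⟨hx, hs⟩
  obtain ⟨χ, hχ, hxχ⟩ := X.exists_chart (h x) (fun hs => hxs ((hh.1 x).1 hs))
  obtain ⟨c, hc⟩ := hh.2 φ hφ χ hχ x hx hxχ
  obtain ⟨d, hd⟩ := hg.2 χ hχ ψ hψ (h x) hxχ hx'
  refine ⟨planeAct A c + d, ?_⟩
  filter_upwards [hc, h.continuous.continuousAt.eventually hd] with y hy hy'
  change ψ (g (h y)) = _
  rw [hy', hy, planeAct_add, planeAct_mul, add_assoc]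

theorem IsAffine.inv {h : S ≃ₜ S} {A : SL(2, ℝ)} (hh : X.IsAffine h A) :
    X.IsAffine h⁻¹ A⁻¹ := by
  have key : ∀ x, h (h⁻¹ x) = x := fun x => h.apply_symm_apply x
  refine ⟨fun x => by rw [← hh.1, key], fun φ hφ ψ hψ x hx hx' => ?_⟩
  obtain ⟨c, hc⟩ := hh.2 ψ hψ φ hφ (h⁻¹ x) hx' (by rwa [key])
  refine ⟨-planeAct A⁻¹ c, ?_⟩
  have hcont : Filter.Tendsto (fun y => h⁻¹ y) (𝓝 x) (𝓝 (h⁻¹ x)) :=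
    (h⁻¹).continuous.continuousAt
  filter_upwards [hcont.eventually hc] with y hy
  rw [key] at hy
  rw [hy, planeAct_add, ← planeAct_mul, inv_mul_cancel, planeAct_one, add_neg_cancel_right]

variable (X)

/-- The group of affine automorphisms of `X`, each recorded together with its linear part
(which it determines). -/
def affineGroup : Subgroup ((S ≃ₜ S) × SL(2, ℝ)) where
  carrier := {g | X.IsAffine g.1 g.2}
  one_mem' := IsAffine.one
  mul_mem' ha hb := IsAffine.mul ha hb
  inv_mem' ha := IsAffine.inv ha

/-- The linear part (derivative) of an affine automorphism. -/
def derivative : X.affineGroup →* SL(2, ℝ) :=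
  (MonoidHom.snd (S ≃ₜ S) SL(2, ℝ)).comp X.affineGroup.subtype

/-- The Veech group: all linear parts of affine automorphisms. -/
def veechGroup : Subgroup SL(2, ℝ) := X.derivative.range

/-- The action of the affine group on `H¹(S, ℝ)`: the automorphism `h` acts by `(h⁻¹)^*`. -/
def cohomologyRep : Representation ℝ X.affineGroup (SingularH1 ℝ S) where
  toFun g := SingularH1.map ⟨(g.1.1⁻¹ : S ≃ₜ S), (g.1.1⁻¹ : S ≃ₜ S).continuous⟩
  map_one' := SingularH1.map_id
  map_mul' g h := by
    rw [Module.End.mul_eq_comp, ← SingularH1.map_comp]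
    congr 1

/-- The translation surface obtained by pulling back the structure of `X` along a local
homeomorphism (in particular, along a covering map); the singular set is the preimage. -/
def pullback {E : Type*} [TopologicalSpace E] (p : E → S) (hp : IsLocalHomeomorph p) :
    TranslationSurface E where
  sing := p ⁻¹' X.sing
  charts := {e | Disjoint e.source (p ⁻¹' X.sing) ∧ ∀ φ ∈ X.charts, ∀ x, x ∈ e.source →
    p x ∈ φ.source → ∃ c : ℂ, ∀ᶠ y in 𝓝 x, φ (p y) = e y + c}
  disjoint_sing := fun e he => he.1
  exists_chart := by
    intro x hx
    obtain ⟨φ, hφ, hxφ⟩ := X.exists_chart (p x) hx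
    obtain ⟨q, hxq, rfl⟩ := hp x
    refine ⟨q.trans φ, ⟨?_, ?_⟩, by simp [hxq, hxφ]⟩
    · rw [Set.disjoint_left]
      intro y hy hy'
      rw [OpenPartialHomeomorph.trans_source] at hy
      exact (X.disjoint_sing φ hφ).le_bot ⟨hy.2, hy'⟩
    · intro ψ hψ y hy hyψ
      rw [OpenPartialHomeomorph.trans_source] at hy
      obtain ⟨c, hc⟩ := X.translation φ hφ ψ hψ (q y) hy.2 hyψ
      exact ⟨c, (q.continuousAt hy.1).eventually hc⟩
  translation := by
    intro e he e' he' x hx hx'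
    have hxs : p x ∉ X.sing := fun hs => he.1.le_bot ⟨hx, hs⟩
    obtain ⟨φ, hφ, hxφ⟩ := X.exists_chart (p x) hxs
    obtain ⟨c, hc⟩ := he.2 φ hφ x hx hxφ
    obtain ⟨c', hc'⟩ := he'.2 φ hφ x hx' hxφ
    refine ⟨c - c', ?_⟩
    filter_upwards [hc, hc'] with y hy hy'
    linear_combination hy - hy'
  cone := by
    intro x hx
    obtain ⟨k, hk, w, hxw, hw0, hws, hw⟩ := X.cone (p x) hx
    obtain ⟨q, hxq, rfl⟩ := hp x
    refine ⟨k, hk, q.trans w, by simp [hxq, hxw], by simpa using hw0, ?_, ?_⟩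
    · ext y
      rw [OpenPartialHomeomorph.trans_source]
      constructor
      · rintro ⟨⟨hyq, hyw⟩, hys⟩
        have : q y ∈ w.source ∩ X.sing := ⟨hyw, hys⟩
        rw [hws] at this
        exact q.injOn hyq hxq this
      · rintro rfl
        exact ⟨⟨hxq, hxw⟩, hx⟩
    · intro e he y hy hye
      rw [OpenPartialHomeomorph.trans_source] at hy
      have hys : q y ∉ X.sing := fun hs => he.1.le_bot ⟨hye, hs⟩
      obtain ⟨φ, hφ, hyφ⟩ := X.exists_chart (q y) hys
      obtain ⟨c, hc⟩ := he.2 φ hφ y hye hyφ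
      obtain ⟨c', hc'⟩ := hw φ hφ (q y) hy.2 hyφ
      refine ⟨c' - c, ?_⟩
      filter_upwards [hc, (q.continuousAt hy.1).eventually hc'] with z hz hz'
      change e z = (w (q z)) ^ k + (c' - c)
      linear_combination hz' - hz

variable {X}

/-- The linear part, on a subgroup `G` of the affine group. Its range is the group of linear
parts of the elements of `G`. -/
def linearPart (G : Subgroup X.affineGroup) : G →* SL(2, ℝ) := X.derivative.comp G.subtype

/-- The action on `H¹(S, ℝ)` of a subgroup `G` of the affine group. -/
def rep (G : Subgroup X.affineGroup) : Representation ℝ G (SingularH1 ℝ S) :=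
  X.cohomologyRep.comp G.subtype

/-- The sum of a family of invariant subspaces. -/
def sumSubrep {G : Subgroup X.affineGroup} {ι : Type*} (F : ι → Subrepresentation (rep G)) :
    Subrepresentation (rep G) where
  toSubmodule := ⨆ j, (F j).toSubmodule
  apply_mem_toSubmodule g v hv := by
    have : (⨆ j, (F j).toSubmodule) ≤ (⨆ j, (F j).toSubmodule).comap (rep G g) :=
      iSup_le fun j u hu =>
        Submodule.mem_iSup_of_mem j ((F j).apply_mem_toSubmodule g hu)
    exact this hv

/-- The kernel of the representation `ρ_F : G → GL(F)` on an invariant subspace `F`. -/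
def repKer {G : Subgroup X.affineGroup} (F : Subrepresentation (rep G)) : Subgroup G :=
  MonoidHom.ker F.toRepresentation

end TranslationSurface

/-- `p : E → S` is the connected abelian cover of `S` defined by the integer classes `f i`: a
connected covering such that a path in `E` joining two points of the same fibre is closed
if and only if all the `f i` vanish on the loop it projects to. In other words,
`p_* π₁(E) = ⋂ i, ker (f i : π₁(S) → ℤ)`. If `f` is a linearly independent `d`-tuple, the group of
deck transformations is isomorphic to `ℤ^d`. -/
structure IsCoverDefinedBy {S E : Type*} [TopologicalSpace S] [TopologicalSpace E] {ι : Type*}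
    (f : ι → SingularH1 ℤ S) (p : C(E, S)) : Prop where
  isCoveringMap : IsCoveringMap p
  connected : ConnectedSpace E
  closed_iff : ∀ (γ : C(I, E)) (hγ : p (γ 0) = p (γ 1)),
    γ 0 = γ 1 ↔ ∀ i, SingularH1.period ℤ (p.comp γ) hγ (f i) = 0

/-! ### Fuchsian groups -/

/-- The limit set of `Γ ≤ SL(2, ℝ)`: the points of the boundary circle `ℝ ∪ {∞}` of the
hyperbolic plane that are limits, in the Riemann sphere, of points of some orbit of `Γ` in the
upper half-plane. -/
def limitSet (Γ : Subgroup SL(2, ℝ)) : Set (OnePoint ℝ) :=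
  {ξ | ∃ z : ℍ, OnePoint.map (fun t : ℝ => (t : ℂ)) ξ ∈
    closure ((fun w : ℍ => (((w : ℂ)) : OnePoint ℂ)) '' MulAction.orbit Γ z)}

/-- `Γ` is a Fuchsian (discrete) group of the first kind: its limit set is the whole
boundary circle. -/
def IsFirstKind (Γ : Subgroup SL(2, ℝ)) : Prop :=
  DiscreteTopology Γ ∧ limitSet Γ = Set.univ

/-- `Γ` is a (non-elementary) Fuchsian group of the second kind: its limit set is infinite and is
not the whole boundary circle. -/
def IsSecondKind (Γ : Subgroup SL(2, ℝ)) : Prop :=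
  DiscreteTopology Γ ∧ (limitSet Γ).Infinite ∧ limitSet Γ ≠ Set.univ

end

/-! The equality `K = ⋂ K_j` is formal: a sum is fixed pointwise exactly when each summand is. The
content is that the linear parts of `K`, the Veech group of the cover and `Γ` are all discrete with
the same limit set; either kind is then read off from that set.

The kernel. A torsion-free `G` is determined by its linear parts (`linearPart_injective`): a
translation automorphism permutes the finite singular set, so a power of it fixes a singularity, and
only finitely many translations do that; hence it has finite order. The `K_j` thus become
non-trivial normal subgroups of a torsion-free non-elementary Fuchsian group. Two such subgroups
meet non-trivially (`inf_ne_bot_of_normal`): otherwise they commute, and a non-trivial element of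
one would act on two different lines by the same eigenvalue, so as a scalar. Hence `K` is
non-trivial, and a non-trivial normal subgroup has the full limit set (`limitSet_map_eq_of_normal`).
Limit points are handled through `mem_limitSet_iff`: they are the image lines of non-zero limits of
rescaled group elements, so any closed homogeneous condition on the matrices of the group is
inherited by these limits.

The cover. Elements of `K` fix the classes `f i`, hence lift, so their linear parts lie in the Veech
group of the cover. Conversely, an affine automorphism of the cover need not descend, but it does if
it normalizes the deck group. The deck group embeds in `ℤ ^ d` and has finite index in the normal
subgroup of all translations of the cover, so a finite-index subgroup of the affine group normalizes
it (`exists_finiteIndex_normalizing`). Up to finite index the Veech group of the cover therefore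
lies in that of `X`, where `Γ` has finite index. Passing to finite index changes neither
discreteness nor the limit set. -/

noncomputable section

/-! ### Limit sets through rank-one limits of matrices -/

namespace Fuchsian

/-- The standard area form on the plane. -/
def area (u v : Fin 2 → ℝ) : ℝ := u 0 * v 1 - u 1 * v 0

/-- A vector spanning the line that corresponds to a point of the boundary circle. -/
def boundaryVec (ξ : OnePoint ℝ) : Fin 2 → ℝ := ξ.elim ![1, 0] fun t => ![t, 1]

/-- The closure of the cone over a group of matrices. -/
def matrixCone (H : Subgroup SL(2, ℝ)) : Set (Matrix (Fin 2) (Fin 2) ℝ) :=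
  closure {M | ∃ c : ℝ, ∃ g ∈ H, M = c • g.1}

theorem tendsto_quotient_of_ne_zero {ι : Type*} {l : Filter ι}
    {M : ι → Matrix (Fin 2) (Fin 2) ℝ} {P : Matrix (Fin 2) (Fin 2) ℝ} (hM : Tendsto M l (𝓝 P))
    (z : ℂ) (hz : (P 1 0 : ℂ) * z + P 1 1 ≠ 0) :
    Tendsto (fun i => (((M i 0 0 : ℂ) * z + M i 0 1) / ((M i 1 0 : ℂ) * z + M i 1 1) : ℂ)) l
      (𝓝 (((P 0 0 : ℂ) * z + P 0 1) / ((P 1 0 : ℂ) * z + P 1 1))) := by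
  have h : ∀ i j, Tendsto (fun k => (M k i j : ℂ)) l (𝓝 (P i j : ℂ)) := fun i j =>
    (Complex.continuous_ofReal.tendsto _).comp
      (((continuous_apply_apply i j).tendsto P).comp hM)
  exact (((h 0 0).mul_const z).add (h 0 1)).div (((h 1 0).mul_const z).add (h 1 1)) hz

theorem tendsto_quotient_infty {ι : Type*} {l : Filter ι}
    {M : ι → Matrix (Fin 2) (Fin 2) ℝ} {P : Matrix (Fin 2) (Fin 2) ℝ} (hM : Tendsto M l (𝓝 P))
    (z : ℂ) (hz : (P 1 0 : ℂ) * z + P 1 1 = 0) (hz' : (P 0 0 : ℂ) * z + P 0 1 ≠ 0)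
    (hden : ∀ᶠ i in l, (M i 1 0 : ℂ) * z + M i 1 1 ≠ 0) :
    Tendsto (fun i => ((((M i 0 0 : ℂ) * z + M i 0 1) / ((M i 1 0 : ℂ) * z + M i 1 1) : ℂ) :
      OnePoint ℂ)) l (𝓝 OnePoint.infty) := by
  have h : ∀ i j, Tendsto (fun k => (M k i j : ℂ)) l (𝓝 (P i j : ℂ)) := fun i j =>
    (Complex.continuous_ofReal.tendsto _).comp
      (((continuous_apply_apply i j).tendsto P).comp hM)
  have h1 := ((h 0 0).mul_const z).add (h 0 1)
  have h2 : Tendsto (fun i => (M i 1 0 : ℂ) * z + M i 1 1) l (𝓝[≠] 0) :=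
    tendsto_nhdsWithin_iff.2 ⟨hz ▸ ((h 1 0).mul_const z).add (h 1 1), hden⟩
  have h3 : Tendsto (fun i => ((M i 0 0 : ℂ) * z + M i 0 1) / ((M i 1 0 : ℂ) * z + M i 1 1)) l
      (Bornology.cobounded ℂ) := by
    rw [← tendsto_norm_atTop_iff_cobounded]
    simp_rw [div_eq_mul_inv, norm_mul]
    refine Tendsto.pos_mul_atTop (norm_pos_iff.2 hz') h1.norm ?_
    exact tendsto_norm_atTop_iff_cobounded.2 (tendsto_inv₀_nhdsNE_zero.comp h2)
  refine OnePoint.tendsto_coe_infty.comp ?_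
  rwa [coclosedCompact_eq_cocompact, ← Metric.cobounded_eq_cocompact]

theorem coe_smul_eq (g : SL(2, ℝ)) (z : ℍ) {c : ℝ} (hc : c ≠ 0) :
    ((g • z : ℍ) : ℂ) = (((c • g.1) 0 0 : ℝ) * (z : ℂ) + ((c • g.1) 0 1 : ℝ)) /
      (((c • g.1) 1 0 : ℝ) * (z : ℂ) + ((c • g.1) 1 1 : ℝ)) := by
  rw [UpperHalfPlane.coe_specialLinearGroup_apply]
  have hc' : (c : ℂ) ≠ 0 := by exact_mod_cast hc
  simp only [Matrix.smul_apply, smul_eq_mul, Complex.ofReal_mul, Algebra.algebraMap_self,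
    RingHom.id_apply, mul_assoc, ← mul_add]
  rw [mul_div_mul_left _ _ hc']

theorem eq_zero_of_mul_add_eq_zero {a b : ℝ} (z : ℍ) (h : (a : ℂ) * z + b = 0) :
    a = 0 ∧ b = 0 := by
  have hi := congrArg Complex.im h
  have hr := congrArg Complex.re h
  simp at hi hr
  have hz : (z : ℂ).im ≠ 0 := z.im_ne_zero
  have ha : a = 0 := by
    rcases hi with h | h
    · exact h
    · exact absurd h z.im_ne_zero
  exact ⟨ha, by simpa [ha] using hr⟩

/-- When orbit points tend to the boundary, the rescaled matrices accumulate at a singular matrix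
`P`, which as a Möbius map is constant on the half-plane. The row equation says that the columns of
`P` lie on the line of `ξ`, i.e. that this constant is `ξ`. -/
theorem mem_limitSet_iff {H : Subgroup SL(2, ℝ)} {ξ : OnePoint ℝ} :
    ξ ∈ limitSet H ↔ ∃ P ∈ matrixCone H, P ≠ 0 ∧
      ∀ j, P 0 j * boundaryVec ξ 1 = P 1 j * boundaryVec ξ 0 := by
  constructor
  · rintro ⟨z, hz⟩
    have hrange : (fun w : ℍ => (((w : ℂ)) : OnePoint ℂ)) '' MulAction.orbit H z =
        range (fun g : H => (((g.1 • z : ℍ) : ℂ) : OnePoint ℂ)) := by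
      rw [MulAction.orbit, ← range_comp]; rfl
    rw [hrange] at hz
    let f : H → OnePoint ℂ := fun g => (((g.1 • z : ℍ) : ℂ) : OnePoint ℂ)
    have hne : (comap f (𝓝 (OnePoint.map (fun t : ℝ => (t : ℂ)) ξ))).NeBot := by
      rw [comap_neBot_iff_frequently]
      exact mem_closure_iff_frequently.1 hz
    -- Along an ultrafilter on `H` whose orbit points tend to `ξ`, the matrices scaled to norm one
    -- converge by compactness of the unit sphere.
    let U := Ultrafilter.of (comap f (𝓝 (OnePoint.map (fun t : ℝ => (t : ℂ)) ξ)))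
    have hU : Tendsto f U (𝓝 (OnePoint.map (fun t : ℝ => (t : ℂ)) ξ)) :=
      tendsto_comap.mono_left (Ultrafilter.of_le _)
    let N : H → Fin 2 → Fin 2 → ℝ := fun g => g.1.1
    have hN : ∀ g, N g ≠ 0 := fun g h => by
      have hd := g.1.2
      have h' : g.1.1 = 0 := h
      rw [h', Matrix.det_zero] at hd
      exact zero_ne_one hd
    have hsph : ∀ g, ‖N g‖⁻¹ • N g ∈ Metric.sphere (0 : Fin 2 → Fin 2 → ℝ) 1 := fun g => by
      rw [mem_sphere_zero_iff_norm, norm_smul, norm_inv, norm_norm,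
        inv_mul_cancel₀ (norm_ne_zero_iff.2 (hN g))]
    obtain ⟨P, hP, hlim⟩ := (isCompact_sphere (0 : Fin 2 → Fin 2 → ℝ) 1).ultrafilter_le_nhds
      (U.map fun g => ‖N g‖⁻¹ • N g) (by
        rw [le_principal_iff]
        exact Eventually.of_forall (f := (U : Filter H)) hsph)
    have hlim' : Tendsto (fun g : H => ‖N g‖⁻¹ • g.1.1) U (𝓝 (Matrix.of P)) := hlim
    have hP0 : ¬ (P 0 0 = 0 ∧ P 0 1 = 0 ∧ P 1 0 = 0 ∧ P 1 1 = 0) := fun h => by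
      have : P = 0 := by ext i j; fin_cases i <;> fin_cases j <;> simp [h]
      simp [this] at hP
    have hf : ∀ g : H, f g = ((((‖N g‖⁻¹ • g.1.1) 0 0 : ℝ) * (z : ℂ) +
        ((‖N g‖⁻¹ • g.1.1) 0 1 : ℝ)) / (((‖N g‖⁻¹ • g.1.1) 1 0 : ℝ) * (z : ℂ) +
          ((‖N g‖⁻¹ • g.1.1) 1 1 : ℝ)) : ℂ) := fun g => by
      change (((g.1 • z : ℍ) : ℂ) : OnePoint ℂ) = _
      rw [coe_smul_eq g.1 z (inv_ne_zero (norm_ne_zero_iff.2 (hN g)))]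
    refine ⟨Matrix.of P, mem_closure_of_tendsto hlim'
      (Eventually.of_forall fun g => ⟨_, g.1, g.2, rfl⟩), fun h => hP0 ?_, ?_⟩
    · have : ∀ i j, P i j = 0 := fun i j => congrFun (congrFun h i) j
      exact ⟨this _ _, this _ _, this _ _, this _ _⟩
    by_cases hden : (P 1 0 : ℂ) * (z : ℂ) + P 1 1 = 0
    · have h1 := eq_zero_of_mul_add_eq_zero z hden
      have h2 := tendsto_quotient_infty hlim' z hden
        (fun h => hP0 ⟨(eq_zero_of_mul_add_eq_zero z h).1, (eq_zero_of_mul_add_eq_zero z h).2, h1⟩)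
        (Eventually.of_forall fun g h => by
          have := eq_zero_of_mul_add_eq_zero z h
          have hd := g.1.2
          simp only [Matrix.smul_apply, smul_eq_mul, mul_eq_zero, inv_eq_zero, norm_eq_zero,
            hN, false_or] at this
          rw [Matrix.det_fin_two, this.1, this.2] at hd
          simp at hd)
      have h3 := tendsto_nhds_unique (hU.congr hf) h2
      induction ξ using OnePoint.rec with
      | infty => simp [boundaryVec, Fin.forall_fin_two, h1]
      | coe t => exact absurd h3 (OnePoint.coe_ne_infty _)
    · have h2 := (OnePoint.continuous_coe.tendsto _).comp
        (tendsto_quotient_of_ne_zero hlim' z hden)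
      have h3 := tendsto_nhds_unique (hU.congr hf) h2
      induction ξ using OnePoint.rec with
      | infty => exact absurd h3 (OnePoint.infty_ne_coe _)
      | coe t =>
        have h4 : (t : ℂ) = ((P 0 0 : ℂ) * z + P 0 1) / ((P 1 0 : ℂ) * z + P 1 1) :=
          OnePoint.coe_injective h3
        rw [eq_div_iff hden] at h4
        -- `P z = t` is a real affine relation in the non-real number `z`, so both of its
        -- coefficients vanish.
        have h5 : ((t * P 1 0 - P 0 0 : ℝ) : ℂ) * z + ((t * P 1 1 - P 0 1 : ℝ) : ℂ) = 0 := by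
          push_cast; linear_combination h4
        have h6 := eq_zero_of_mul_add_eq_zero z h5
        simp only [boundaryVec, Fin.forall_fin_two, OnePoint.elim_some, Matrix.of_apply]
        simp
        constructor <;> linarith
  · rintro ⟨P, hP, hP0, hrow⟩
    have : FirstCountableTopology (Matrix (Fin 2) (Fin 2) ℝ) :=
      inferInstanceAs (FirstCountableTopology (Fin 2 → Fin 2 → ℝ))
    obtain ⟨x, hx, hlim⟩ := mem_closure_iff_seq_limit.1 hP
    choose c g hg hxc using hx
    have hc : ∀ᶠ n in atTop, c n ≠ 0 := by
      filter_upwards [hlim.eventually_ne hP0] with n hn hc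
      exact hn (by rw [hxc, hc, zero_smul])
    -- `P` sends every point of the half-plane to `ξ`, so any base point would do.
    refine ⟨UpperHalfPlane.I, ?_⟩
    have key : ∀ᶠ n in atTop, ((((g n) • UpperHalfPlane.I : ℍ) : ℂ) : OnePoint ℂ) =
        (((((x n) 0 0 : ℝ) * (UpperHalfPlane.I : ℂ) + ((x n) 0 1 : ℝ)) /
      (((x n) 1 0 : ℝ) * (UpperHalfPlane.I : ℂ) + ((x n) 1 1 : ℝ)) : ℂ) : OnePoint ℂ) := by
      filter_upwards [hc] with n hn
      rw [coe_smul_eq (g n) _ hn, hxc]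
    have hmem : ∀ n, ((((g n) • UpperHalfPlane.I : ℍ) : ℂ) : OnePoint ℂ) ∈
        (fun w : ℍ => (((w : ℂ)) : OnePoint ℂ)) '' MulAction.orbit H UpperHalfPlane.I :=
      fun n => ⟨_, ⟨⟨g n, hg n⟩, rfl⟩, rfl⟩
    refine mem_closure_of_tendsto (Tendsto.congr' (key.mono fun _ h => h.symm) ?_)
      (Eventually.of_forall hmem)
    have hne : ¬ (P 0 0 = 0 ∧ P 0 1 = 0 ∧ P 1 0 = 0 ∧ P 1 1 = 0) := fun h => hP0 (by
      ext i j; fin_cases i <;> fin_cases j <;> simp [h])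
    have h0 := hrow 0
    have h1 := hrow 1
    induction ξ using OnePoint.rec with
    | infty =>
      simp [boundaryVec] at h0 h1
      refine tendsto_quotient_infty hlim _ (by simp [← h0, ← h1]) (fun h => ?_) ?_
      · have := eq_zero_of_mul_add_eq_zero _ h
        exact hne ⟨this.1, this.2, h0.symm, h1.symm⟩
      · filter_upwards [hc] with n hn h
        have := eq_zero_of_mul_add_eq_zero _ h
        have hd := (g n).2
        simp only [hxc, Matrix.smul_apply, smul_eq_mul, mul_eq_zero, hn, false_or] at this
        rw [Matrix.det_fin_two, this.1, this.2] at hd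
        simp at hd
    | coe t =>
      simp [boundaryVec] at h0 h1
      have hden : (P 1 0 : ℂ) * (UpperHalfPlane.I : ℂ) + P 1 1 ≠ 0 := fun h => by
        have := eq_zero_of_mul_add_eq_zero _ h
        exact hne ⟨by rw [h0, this.1, zero_mul], by rw [h1, this.2, zero_mul], this⟩
      have := tendsto_quotient_of_ne_zero hlim _ hden
      refine ((OnePoint.continuous_coe.tendsto _).comp this).trans (le_of_eq ?_)
      congr 1
      change _ = ((t : ℂ) : OnePoint ℂ)
      congr 1
      rw [h0, h1, div_eq_iff hden]; push_cast; ring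

end Fuchsian

/-! ### Limit sets of finite-index, normal and elementary subgroups -/

namespace Fuchsian

theorem finite_setOf_area_boundaryVec_eq_zero {u : Fin 2 → ℝ} (hu : u ≠ 0) :
    {ξ | area (boundaryVec ξ) u = 0}.Finite := by
  refine Set.Subsingleton.finite fun ξ hξ η hη => ?_
  have hu' : ¬ (u 0 = 0 ∧ u 1 = 0) := fun h => hu (by ext i; fin_cases i <;> simp [h])
  induction ξ using OnePoint.rec with
  | infty =>
    induction η using OnePoint.rec with
    | infty => rfl
    | coe t =>
      simp [area, boundaryVec] at hξ hη
      exact absurd ⟨by simpa [hξ] using hη, hξ⟩ hu'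
  | coe s =>
    induction η using OnePoint.rec with
    | infty =>
      simp [area, boundaryVec] at hξ hη
      exact absurd ⟨by simpa [hη] using hξ, hη⟩ hu'
    | coe t =>
      simp [area, boundaryVec] at hξ hη
      have h : (s - t) * u 1 = 0 := by linarith
      rcases mul_eq_zero.1 h with h | h
      · rw [sub_eq_zero.1 h]
      · exact absurd ⟨by rw [h] at hξ; linarith, h⟩ hu'

theorem limitSet_mono {H K : Subgroup SL(2, ℝ)} (h : H ≤ K) : limitSet H ⊆ limitSet K := by
  intro ξ hξ
  rw [mem_limitSet_iff] at hξ ⊢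
  obtain ⟨P, hP, h'⟩ := hξ
  refine ⟨P, closure_mono ?_ hP, h'⟩
  rintro _ ⟨c, g, hg, rfl⟩
  exact ⟨c, g, h hg, rfl⟩

/-- A subgroup of finite index has the same limit set. -/
theorem limitSet_eq_of_relIndex_ne_zero {H K : Subgroup SL(2, ℝ)} (h : H ≤ K)
    (hfin : H.relIndex K ≠ 0) : limitSet H = limitSet K := by
  refine (limitSet_mono h).antisymm ?_
  rintro ξ ⟨z, hz⟩
  have : (H.subgroupOf K).FiniteIndex := ⟨hfin⟩
  have : Finite (K ⧸ H.subgroupOf K) := inferInstance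
  have hsub : (fun w : ℍ => (((w : ℂ)) : OnePoint ℂ)) '' MulAction.orbit K z ⊆
      ⋃ q : K ⧸ H.subgroupOf K, (fun w : ℍ => (((w : ℂ)) : OnePoint ℂ)) ''
        MulAction.orbit H ((q.out⁻¹ : K) • z) := by
    rintro _ ⟨_, ⟨k, rfl⟩, rfl⟩
    -- With `q` the representative of the left coset of `k⁻¹`, one has `k = (k * q) * q⁻¹` and `k *
    -- q ∈ H`: the orbit of `K` is a finite union of orbits of `H`.
    refine mem_iUnion.2 ⟨QuotientGroup.mk k⁻¹, _, ?_, rfl⟩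
    have hk : (k * (QuotientGroup.mk (s := H.subgroupOf K) k⁻¹).out) ∈ H.subgroupOf K := by
      have := QuotientGroup.eq.1 (QuotientGroup.out_eq' (QuotientGroup.mk (s := H.subgroupOf K) k⁻¹))
      simpa using (H.subgroupOf K).inv_mem this
    refine ⟨⟨_, Subgroup.mem_subgroupOf.1 hk⟩, ?_⟩
    change ((k * _ : K) : SL(2, ℝ)) • ((_ : K) : SL(2, ℝ)) • z = (k : SL(2, ℝ)) • z
    rw [smul_smul, ← Subgroup.coe_mul, mul_inv_cancel_right]
  have hz' := closure_mono hsub hz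
  rw [closure_iUnion_of_finite] at hz'
  obtain ⟨q, hq⟩ := mem_iUnion.1 hz'
  exact ⟨_, hq⟩

theorem area_smul_right (c : ℝ) (u v : Fin 2 → ℝ) : area u (c • v) = c * area u v := by
  simp [area]; ring

theorem area_add_right (u v w : Fin 2 → ℝ) : area u (v + w) = area u v + area u w := by
  simp [area]; ring

theorem area_self (u : Fin 2 → ℝ) : area u u = 0 := by
  simp [area]; ring

theorem area_mulVec (g : SL(2, ℝ)) (u v : Fin 2 → ℝ) :
    area (g.1.mulVec u) (g.1.mulVec v) = area u v := by
  have h := g.2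
  rw [Matrix.det_fin_two] at h
  simp only [area, Matrix.mulVec, dotProduct, Fin.sum_univ_two]
  linear_combination (u 0 * v 1 - u 1 * v 0) * h

theorem area_eq_zero_iff {u v : Fin 2 → ℝ} (hu : u ≠ 0) : area u v = 0 ↔ ∃ c : ℝ, v = c • u := by
  constructor
  · intro h
    have hu' : u 0 ≠ 0 ∨ u 1 ≠ 0 := by
      by_contra! hcon
      exact hu (by ext i; fin_cases i <;> simp [hcon])
    unfold area at h
    rcases hu' with h0 | h0
    · refine ⟨v 0 / u 0, ?_⟩
      ext i; fin_cases i
      · simp [h0]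
      · simp; field_simp; linarith
    · refine ⟨v 1 / u 1, ?_⟩
      ext i; fin_cases i
      · simp; field_simp; linarith
      · simp [h0]
  · rintro ⟨c, rfl⟩
    rw [area_smul_right, area_self, mul_zero]

theorem left_ne_zero_of_area_ne_zero {u v : Fin 2 → ℝ} (h : area u v ≠ 0) : u ≠ 0 := by
  rintro rfl; simp [area] at h

theorem right_ne_zero_of_area_ne_zero {u v : Fin 2 → ℝ} (h : area u v ≠ 0) : v ≠ 0 := by
  rintro rfl; simp [area] at h

/-- Linear maps that agree on a basis are equal. -/
theorem matrix_ext_of_area_ne_zero {u v : Fin 2 → ℝ} (h : area u v ≠ 0)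
    {M N : Matrix (Fin 2) (Fin 2) ℝ} (hu : M.mulVec u = N.mulVec u)
    (hv : M.mulVec v = N.mulVec v) : M = N := by
  have key : ∀ a b : ℝ, a * u 0 + b * u 1 = 0 → a * v 0 + b * v 1 = 0 → a = 0 ∧ b = 0 := by
    intro a b h1 h2
    unfold area at h
    constructor
    · have : a * (u 0 * v 1 - u 1 * v 0) = 0 := by linear_combination v 1 * h1 - u 1 * h2
      exact (mul_eq_zero.1 this).resolve_right h
    · have : b * (u 0 * v 1 - u 1 * v 0) = 0 := by linear_combination u 0 * h2 - v 0 * h1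
      exact (mul_eq_zero.1 this).resolve_right h
  ext i j
  have h1 := congrFun hu i
  have h2 := congrFun hv i
  simp only [Matrix.mulVec, dotProduct, Fin.sum_univ_two] at h1 h2
  have := key (M i 0 - N i 0) (M i 1 - N i 1) (by linarith) (by linarith)
  fin_cases j
  · exact sub_eq_zero.1 this.1
  · exact sub_eq_zero.1 this.2

/-- A normal subgroup that fixes no point of the boundary has the same limit set. -/
theorem limitSet_subset_of_normal {Γ N : Subgroup SL(2, ℝ)}
    (hconj : ∀ g ∈ Γ, ∀ n ∈ N, g * n * g⁻¹ ∈ N)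
    (hfix : ∀ u : Fin 2 → ℝ, u ≠ 0 → ∃ n ∈ N, area u (n.1.mulVec u) ≠ 0) :
    limitSet Γ ⊆ limitSet N := by
  intro ξ hξ
  rw [mem_limitSet_iff] at hξ ⊢
  obtain ⟨A, hA, hA0, hrow⟩ := hξ
  -- For `B = c • g` the product `B * n * adj B` is `c ^ 2 • (g n g⁻¹)`, and this expression is
  -- continuous in `B`, unlike the one with the inverse.
  have hcone : ∀ n ∈ N, A * n.1 * A.adjugate ∈ matrixCone N := by
    intro n hn
    refine map_mem_closure (f := fun B : Matrix (Fin 2) (Fin 2) ℝ => B * n.1 * B.adjugate)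
      (by fun_prop) hA ?_
    rintro _ ⟨c, g, hg, rfl⟩
    refine ⟨c * c, _, hconj g hg n hn, ?_⟩
    simp only [Matrix.adjugate_smul, Matrix.SpecialLinearGroup.coe_mul,
      Matrix.SpecialLinearGroup.coe_inv]
    simp [smul_smul]
  have hrow' : ∀ B : Matrix (Fin 2) (Fin 2) ℝ, ∀ j,
      (A * B) 0 j * boundaryVec ξ 1 = (A * B) 1 j * boundaryVec ξ 0 := by
    intro B j
    simp only [Matrix.mul_apply, Fin.sum_univ_two]
    linear_combination B 0 j * hrow 0 + B 1 j * hrow 1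
  -- This vector spans the kernel of a non-zero row of `A`. Up to sign, its area with its image
  -- under `n` is the `(i, 1 - i)` entry of `A * n * adj A`, so the product is non-zero once `n`
  -- moves the line.
  obtain ⟨i, hi⟩ : ∃ i, ![A i 1, -A i 0] ≠ 0 := by
    by_contra! hcon
    apply hA0
    ext i j
    have h0 := congrFun (hcon i) 0
    have h1 := congrFun (hcon i) 1
    simp at h0 h1
    fin_cases j
    · exact h1
    · exact h0
  obtain ⟨n, hn, hne⟩ := hfix _ hi
  refine ⟨A * n.1 * A.adjugate, hcone n hn, fun h => hne ?_, ?_⟩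
  · have h' := congrFun (congrFun h i) (1 - i)
    rw [Matrix.adjugate_fin_two] at h'
    fin_cases i <;>
    simp [Matrix.mul_apply, Fin.sum_univ_two, area, Matrix.mulVec, dotProduct] at h' ⊢ <;> linarith
  · rw [mul_assoc]
    exact hrow' _

/-- A group that preserves a pair of points of the boundary has a finite limit set. -/
theorem finite_limitSet_of_pair {Γ : Subgroup SL(2, ℝ)} {u v : Fin 2 → ℝ} (huv : area u v ≠ 0)
    (h : ∀ g ∈ Γ, (area u (g.1.mulVec u) = 0 ∧ area v (g.1.mulVec v) = 0) ∨
      (area v (g.1.mulVec u) = 0 ∧ area u (g.1.mulVec v) = 0)) : (limitSet Γ).Finite := by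
  have hcont : ∀ a b : Fin 2 → ℝ,
      Continuous fun M : Matrix (Fin 2) (Fin 2) ℝ => area a (M.mulVec b) := by
    intro a b
    unfold area
    fun_prop
  have hclosed : IsClosed {M : Matrix (Fin 2) (Fin 2) ℝ |
      (area u (M.mulVec u) = 0 ∧ area v (M.mulVec v) = 0) ∨
      (area v (M.mulVec u) = 0 ∧ area u (M.mulVec v) = 0)} := by
    refine IsClosed.union (IsClosed.inter ?_ ?_) (IsClosed.inter ?_ ?_) <;>
    exact isClosed_eq (hcont _ _) continuous_const
  -- The condition is closed and homogeneous, so it passes to the cone. A non-zero limit with image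
  -- line `ξ` does not kill both `u` and `v`, and the surviving image is parallel to `u` or `v`.
  have hsub : matrixCone Γ ⊆ {M : Matrix (Fin 2) (Fin 2) ℝ |
      (area u (M.mulVec u) = 0 ∧ area v (M.mulVec v) = 0) ∨
      (area v (M.mulVec u) = 0 ∧ area u (M.mulVec v) = 0)} := by
    refine closure_minimal ?_ hclosed
    rintro _ ⟨c, g, hg, rfl⟩
    simp only [mem_ofPred_eq, Matrix.smul_mulVec, area_smul_right]
    rcases h g hg with h | h
    · exact Or.inl ⟨by rw [h.1, mul_zero], by rw [h.2, mul_zero]⟩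
    · exact Or.inr ⟨by rw [h.1, mul_zero], by rw [h.2, mul_zero]⟩
  refine ((finite_setOf_area_boundaryVec_eq_zero (left_ne_zero_of_area_ne_zero huv)).union
    (finite_setOf_area_boundaryVec_eq_zero (right_ne_zero_of_area_ne_zero huv))).subset ?_
  intro ξ hξ
  obtain ⟨P, hP, hP0, hrow⟩ := mem_limitSet_iff.1 hξ
  have him : ∀ x, area (boundaryVec ξ) (P.mulVec x) = 0 := by
    intro x
    simp only [area, Matrix.mulVec, dotProduct, Fin.sum_univ_two]
    linear_combination - x 0 * hrow 0 - x 1 * hrow 1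
  have hpar : ∀ a b : Fin 2 → ℝ, b ≠ 0 → area a b = 0 → area (boundaryVec ξ) b = 0 →
      area (boundaryVec ξ) a = 0 := by
    intro a b hb h1 h2
    have hb' : b 0 ≠ 0 ∨ b 1 ≠ 0 := by
      by_contra! hcon
      exact hb (by ext i; fin_cases i <;> simp [hcon])
    unfold area at *
    rcases hb' with hb | hb
    · refine (mul_eq_zero.1 (?_ : b 0 * _ = 0)).resolve_left hb
      linear_combination a 0 * h2 - boundaryVec ξ 0 * h1
    · refine (mul_eq_zero.1 (?_ : b 1 * _ = 0)).resolve_left hb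
      linear_combination a 1 * h2 - boundaryVec ξ 1 * h1
  have hne : P.mulVec u ≠ 0 ∨ P.mulVec v ≠ 0 := by
    by_contra! hcon
    exact hP0 (matrix_ext_of_area_ne_zero huv (by simp [hcon]) (by simp [hcon]))
  rcases hsub hP with h | h <;> rcases hne with h' | h'
  · exact Or.inl (hpar _ _ h' h.1 (him _))
  · exact Or.inr (hpar _ _ h' h.2 (him _))
  · exact Or.inr (hpar _ _ h' h.1 (him _))
  · exact Or.inl (hpar _ _ h' h.2 (him _))

/-- A group whose elements all have a given vector as eigenvector, with eigenvalue `1` or `-1`,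
has a finite limit set. -/
theorem finite_limitSet_of_parabolic {Γ : Subgroup SL(2, ℝ)} {u : Fin 2 → ℝ} (hu : u ≠ 0)
    (h : ∀ g ∈ Γ, (2 : ℝ) • g.1.mulVec u = g.1.trace • u) : (limitSet Γ).Finite := by
  -- This form of the eigenvalue condition is linear in the matrix, so limits inherit it. A rank-one
  -- `P` has eigenvalues `0` and `trace P`; having `trace P / 2` as an eigenvalue makes it
  -- nilpotent, so `u` lies in its kernel, which is its image line `ξ`.
  have hsub : matrixCone Γ ⊆ {M | (2 : ℝ) • M.mulVec u = M.trace • u} := by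
    refine closure_minimal ?_ (isClosed_eq (by fun_prop) (by fun_prop))
    rintro _ ⟨c, g, hg, rfl⟩
    simp only [mem_ofPred_eq, Matrix.smul_mulVec, Matrix.trace_smul]
    rw [smul_comm, h g hg, smul_assoc]
  refine (finite_setOf_area_boundaryVec_eq_zero hu).subset fun ξ hξ => ?_
  obtain ⟨P, hP, hP0, hrow⟩ := mem_limitSet_iff.1 hξ
  have hPu := hsub hP
  have e0 := congrFun hPu 0
  have e1 := congrFun hPu 1
  have hne : ¬ (P 0 0 = 0 ∧ P 0 1 = 0 ∧ P 1 0 = 0 ∧ P 1 1 = 0) := fun h => hP0 (by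
    ext i j; fin_cases i <;> fin_cases j <;> simp [h])
  have hu' : ¬ (u 0 = 0 ∧ u 1 = 0) := fun h => hu (by ext i; fin_cases i <;> simp [h])
  have r0 := hrow 0
  have r1 := hrow 1
  simp only [Pi.smul_apply, smul_eq_mul, Matrix.mulVec, dotProduct, Fin.sum_univ_two,
    Matrix.trace_fin_two] at e0 e1
  change area _ _ = 0
  induction ξ using OnePoint.rec with
  | infty =>
    simp [boundaryVec] at r0 r1
    simp [area, boundaryVec]
    rw [← r0, ← r1] at e1
    rw [← r1] at e0
    by_contra hu1
    have ha : P 0 0 = 0 := by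
      have : P 0 0 * u 1 = 0 := by linarith
      exact (mul_eq_zero.1 this).resolve_right hu1
    have hb : P 0 1 = 0 := by
      have : P 0 1 * u 1 = 0 := by rw [ha] at e0; linarith
      exact (mul_eq_zero.1 this).resolve_right hu1
    exact hne ⟨ha, hb, r0.symm, r1.symm⟩
  | coe t =>
    simp [boundaryVec] at r0 r1
    simp [area, boundaryVec]
    rw [r0, r1] at e0
    rw [r0] at e1
    have hτ : (P 1 0 * t + P 1 1) * (u 0 - t * u 1) = 0 := by linear_combination t * e1 - e0
    rcases mul_eq_zero.1 hτ with hτ | hτ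
    · have hd : P 1 1 = - t * P 1 0 := by linarith
      have hc : P 1 0 * (u 0 - t * u 1) = 0 := by rw [hd] at e1; linarith
      rcases mul_eq_zero.1 hc with hc | hc
      · exact absurd ⟨by rw [r0, hc, zero_mul], by rw [r1, hd, hc]; ring, hc, by rw [hd, hc]; ring⟩ hne
      · linarith
    · linarith

end Fuchsian

namespace Fuchsian

/-! ### Discrete groups -/

/-- A discrete subgroup is closed, so the limit belongs to it and is isolated there. -/
theorem eventually_eq_of_tendsto {Γ : Subgroup SL(2, ℝ)} (hΓ : DiscreteTopology Γ)
    {h : ℕ → SL(2, ℝ)} (hmem : ∀ k, h k ∈ Γ) {L : Matrix (Fin 2) (Fin 2) ℝ}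
    (hL : Tendsto (fun k => (h k).1) atTop (𝓝 L)) : ∀ᶠ k in atTop, (h k).1 = L := by
  have hdet : L.det = 1 := by
    have h1 : Tendsto (fun k => (h k).1.det) atTop (𝓝 L.det) :=
      ((Continuous.matrix_det continuous_id).tendsto L).comp hL
    simp only [(h _).2] at h1
    exact tendsto_nhds_unique h1 tendsto_const_nhds |>.symm ▸ rfl
  have h2 : Tendsto h atTop (𝓝 (⟨L, hdet⟩ : SL(2, ℝ))) := tendsto_subtype_rng.2 hL
  have hcl : IsClosed (Γ : Set SL(2, ℝ)) := Subgroup.isClosed_of_discrete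
  have h3 : (⟨L, hdet⟩ : SL(2, ℝ)) ∈ Γ := hcl.mem_of_tendsto h2 (Eventually.of_forall hmem)
  have h4 : Tendsto (fun k => (⟨h k, hmem k⟩ : Γ)) atTop (𝓝 ⟨⟨L, hdet⟩, h3⟩) :=
    tendsto_subtype_rng.2 h2
  rw [nhds_discrete, tendsto_pure] at h4
  filter_upwards [h4] with k hk
  exact congrArg (fun g : Γ => g.1.1) hk

/-- Cayley–Hamilton: `g ^ 2 = trace g • g - 1`. -/
theorem pow_eq_linear (g : SL(2, ℝ)) (k : ℕ) : ∃ p q : ℝ, (g ^ k).1 = p • g.1 + q • 1 := by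
  induction k with
  | zero => exact ⟨0, 1, by simp⟩
  | succ k ih =>
    obtain ⟨p, q, h⟩ := ih
    refine ⟨p * g.1.trace + q, -p, ?_⟩
    have hd := g.2
    rw [Matrix.det_fin_two] at hd
    rw [pow_succ, Matrix.SpecialLinearGroup.coe_mul, h]
    ext i j
    fin_cases i <;> fin_cases j <;>
    simp [Matrix.mul_apply, Fin.sum_univ_two, Matrix.trace_fin_two]
    · linear_combination (-p) * hd
    · ring
    · ring
    · linear_combination (-p) * hd

/-- Elliptic elements of discrete groups have finite order. -/
theorem isOfFinOrder_of_trace_sq_lt {Γ : Subgroup SL(2, ℝ)} (hΓ : DiscreteTopology Γ)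
    {g : SL(2, ℝ)} (hg : g ∈ Γ) (htr : g.1.trace ^ 2 < 4) : IsOfFinOrder g := by
  choose p q hpq using pow_eq_linear g
  set τ := g.1.trace with hτ
  have hd := g.2
  rw [Matrix.det_fin_two] at hd
  -- This is `det (g ^ k) = 1`. The quadratic form is definite because `τ ^ 2 < 4`, so the
  -- coefficients are bounded; a convergent subsequence of powers is eventually constant by
  -- discreteness, and two powers coincide.
  have hquad : ∀ k, p k ^ 2 + p k * q k * τ + q k ^ 2 = 1 := by
    intro k
    have h := (g ^ k).2
    rw [hpq, Matrix.det_fin_two] at h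
    simp at h
    rw [hτ, Matrix.trace_fin_two]
    linear_combination h - p k ^ 2 * hd
  have hbound : ∀ k, p k ^ 2 ≤ 4 / (4 - τ ^ 2) ∧ q k ^ 2 ≤ 4 / (4 - τ ^ 2) := by
    intro k
    have h4 : 0 < 4 - τ ^ 2 := by linarith
    constructor
    · rw [le_div_iff₀ h4]
      nlinarith [hquad k, sq_nonneg (2 * q k + p k * τ)]
    · rw [le_div_iff₀ h4]
      nlinarith [hquad k, sq_nonneg (2 * p k + q k * τ)]
  have hmem : ∀ k, (p k, q k) ∈ Icc (-(4 / (4 - τ ^ 2) + 1)) (4 / (4 - τ ^ 2) + 1) ×ˢ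
      Icc (-(4 / (4 - τ ^ 2) + 1)) (4 / (4 - τ ^ 2) + 1) := by
    intro k
    obtain ⟨h1, h2⟩ := hbound k
    generalize 4 / (4 - τ ^ 2) = K at h1 h2
    refine ⟨⟨?_, ?_⟩, ⟨?_, ?_⟩⟩ <;> simp only <;> nlinarith
  obtain ⟨⟨p', q'⟩, -, φ, hφ, hlim⟩ := (isCompact_Icc.prod isCompact_Icc).tendsto_subseq hmem
  have hlim' : Tendsto (fun k => (g ^ φ k).1) atTop (𝓝 (p' • g.1 + q' • 1)) := by
    simp_rw [hpq]
    have h1 : Tendsto (fun k => p (φ k)) atTop (𝓝 p') := (continuous_fst.tendsto _).comp hlim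
    have h2 : Tendsto (fun k => q (φ k)) atTop (𝓝 q') := (continuous_snd.tendsto _).comp hlim
    exact (h1.smul_const _).add (h2.smul_const _)
  obtain ⟨k, hk, hk'⟩ := ((eventually_eq_of_tendsto hΓ (fun k => Γ.pow_mem hg _) hlim').and
    ((tendsto_add_atTop_nat 1).eventually
      (eventually_eq_of_tendsto hΓ (fun k => Γ.pow_mem hg _) hlim'))).exists
  have heq : g ^ φ k = g ^ φ (k + 1) := Subtype.ext (hk.trans hk'.symm)
  have hlt : φ k < φ (k + 1) := hφ (Nat.lt_succ_self k)
  rw [isOfFinOrder_iff_pow_eq_one]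
  refine ⟨φ (k + 1) - φ k, by omega, ?_⟩
  have : g ^ φ k * g ^ (φ (k + 1) - φ k) = g ^ φ k * 1 := by
    rw [← pow_add, Nat.add_sub_cancel' hlt.le, mul_one, heq]
  exact mul_left_cancel this

theorem exists_eigenvector {g : SL(2, ℝ)} (htr : 4 ≤ g.1.trace ^ 2) :
    ∃ u : Fin 2 → ℝ, u ≠ 0 ∧ ∃ c : ℝ, g.1.mulVec u = c • u := by
  have hd := g.2
  rw [Matrix.det_fin_two] at hd
  by_cases hc : g.1 1 0 = 0
  · refine ⟨![1, 0], fun h => by simpa using congrFun h 0, g.1 0 0, ?_⟩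
    ext i; fin_cases i <;> simp [Matrix.mulVec, dotProduct, Fin.sum_univ_two, hc]
  · set l := (g.1.trace + √(g.1.trace ^ 2 - 4)) / 2 with hl
    have hl' : l ^ 2 - g.1.trace * l + 1 = 0 := by
      have := Real.sq_sqrt (show 0 ≤ g.1.trace ^ 2 - 4 by linarith)
      rw [hl]; linear_combination this / 4
    rw [Matrix.trace_fin_two] at hl'
    refine ⟨![l - g.1 1 1, g.1 1 0], fun h => hc (by simpa using congrFun h 1), l, ?_⟩
    ext i; fin_cases i <;> simp [Matrix.mulVec, dotProduct, Fin.sum_univ_two]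
    · linear_combination -hl' - hd
    · ring

theorem eigenvalue_sq {g : SL(2, ℝ)} {u : Fin 2 → ℝ} (hu : u ≠ 0) {c : ℝ}
    (h : g.1.mulVec u = c • u) : c ^ 2 - g.1.trace * c + 1 = 0 := by
  have hd := g.2
  rw [Matrix.det_fin_two] at hd
  have h0 := congrFun h 0
  have h1 := congrFun h 1
  simp only [Matrix.mulVec, dotProduct, Fin.sum_univ_two, Pi.smul_apply, smul_eq_mul] at h0 h1
  have hu' : u 0 ≠ 0 ∨ u 1 ≠ 0 := by
    by_contra! hcon
    exact hu (by ext i; fin_cases i <;> simp [hcon])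
  rw [Matrix.trace_fin_two]
  rcases hu' with hu | hu
  · refine (mul_eq_zero.1 (?_ : u 0 * _ = 0)).resolve_left hu
    linear_combination (g.1 1 1 - c) * h0 - g.1 0 1 * h1 - u 0 * hd
  · refine (mul_eq_zero.1 (?_ : u 1 * _ = 0)).resolve_left hu
    linear_combination (g.1 0 0 - c) * h1 - g.1 1 0 * h0 - u 1 * hd

/-- By Cayley–Hamilton `(g - c⁻¹)(g - c) = 0`, so `g - c` maps any vector into the `c⁻¹`-eigenspace.
It is applied to `u` rotated by a right angle; `c ^ 2 ≠ 1` keeps the result off the line of `u`. -/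
theorem exists_second_eigenvector {g : SL(2, ℝ)} {u : Fin 2 → ℝ} (hu : u ≠ 0) {c : ℝ}
    (h : g.1.mulVec u = c • u) (hc : c ^ 2 ≠ 1) :
    ∃ v, area u v ≠ 0 ∧ g.1.mulVec v = c⁻¹ • v := by
  have hchar := eigenvalue_sq hu h
  have hc0 : c ≠ 0 := by rintro rfl; simp at hchar
  have hinv : c⁻¹ * c = 1 := inv_mul_cancel₀ hc0
  have htr : g.1.trace = c + c⁻¹ := by
    field_simp; linarith
  have hd := g.2
  rw [Matrix.det_fin_two] at hd
  rw [Matrix.trace_fin_two] at htr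
  set w : Fin 2 → ℝ := ![-u 1, u 0]
  have hw : area u w ≠ 0 := by
    simp [area, w]
    intro h0
    have h1 : u 0 = 0 := by nlinarith [sq_nonneg (u 0), sq_nonneg (u 1)]
    have h2 : u 1 = 0 := by nlinarith [sq_nonneg (u 0), sq_nonneg (u 1)]
    exact hu (by ext i; fin_cases i <;> simp [h1, h2])
  refine ⟨g.1.mulVec w + (-c) • w, ?_, ?_⟩
  · have h1 : c * area u (g.1.mulVec w) = area u w := by
      rw [← area_mulVec g u w, h]
      simp [area]; ring
    rw [area_add_right, area_smul_right]
    intro h2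
    apply hc
    have h3 : (1 - c ^ 2) * area u w = 0 := by linear_combination c * h2 - h1
    linarith [(mul_eq_zero.1 h3).resolve_right hw]
  · ext i
    simp only [Matrix.mulVec, dotProduct, Fin.sum_univ_two, Pi.smul_apply, smul_eq_mul,
      Pi.add_apply]
    fin_cases i <;> simp only [Fin.zero_eta, Fin.mk_one, Fin.isValue]
    · linear_combination (-w 0) * hd + (g.1 0 0 * w 0 + g.1 0 1 * w 1) * htr + w 0 * hinv
    · linear_combination (-w 1) * hd + (g.1 1 0 * w 0 + g.1 1 1 * w 1) * htr + w 1 * hinv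

theorem exists_eq_combination {u v : Fin 2 → ℝ} (h : area u v ≠ 0) (x : Fin 2 → ℝ) :
    ∃ a b : ℝ, x = a • u + b • v := by
  refine ⟨area x v / area u v, area u x / area u v, ?_⟩
  ext i
  simp only [Pi.add_apply, Pi.smul_apply, smul_eq_mul]
  field_simp
  unfold area
  fin_cases i <;> simp <;> ring

/-- The linear map that sends a basis `u`, `v` to the vectors `x`, `y`. -/
def basisMatrix (u v x y : Fin 2 → ℝ) : Matrix (Fin 2) (Fin 2) ℝ :=
  Matrix.of fun i j => (area u v)⁻¹ * ![x i * v 1 - y i * u 1, y i * u 0 - x i * v 0] j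

theorem basisMatrix_left {u v : Fin 2 → ℝ} (h : area u v ≠ 0) (x y : Fin 2 → ℝ) :
    (basisMatrix u v x y).mulVec u = x := by
  ext i
  simp only [basisMatrix, Matrix.mulVec, dotProduct, Fin.sum_univ_two, Matrix.of_apply]
  simp
  field_simp
  unfold area; ring

theorem basisMatrix_right {u v : Fin 2 → ℝ} (h : area u v ≠ 0) (x y : Fin 2 → ℝ) :
    (basisMatrix u v x y).mulVec v = y := by
  ext i
  simp only [basisMatrix, Matrix.mulVec, dotProduct, Fin.sum_univ_two, Matrix.of_apply]
  simp
  field_simp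
  unfold area; ring

theorem continuous_basisMatrix (u v x : Fin 2 → ℝ) : Continuous (basisMatrix u v x) := by
  refine continuous_matrix fun i j => ?_
  fin_cases j <;> simp only [basisMatrix, Matrix.of_apply] <;> simp <;> fun_prop

theorem pow_mulVec {g : SL(2, ℝ)} {u : Fin 2 → ℝ} {c : ℝ} (h : g.1.mulVec u = c • u) (k : ℕ) :
    (g ^ k).1.mulVec u = c ^ k • u := by
  induction k with
  | zero => simp
  | succ k ih =>
    rw [pow_succ, Matrix.SpecialLinearGroup.coe_mul, ← Matrix.mulVec_mulVec, h,
      Matrix.mulVec_smul, ih, smul_smul, pow_succ, mul_comm]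

theorem inv_mulVec {g : SL(2, ℝ)} {u : Fin 2 → ℝ} {c : ℝ} (hc : c ≠ 0)
    (h : g.1.mulVec u = c • u) : (g⁻¹).1.mulVec u = c⁻¹ • u := by
  have h1 : (g⁻¹).1.mulVec (g.1.mulVec u) = u := by
    rw [Matrix.mulVec_mulVec, ← Matrix.SpecialLinearGroup.coe_mul, inv_mul_cancel]
    simp
  rw [h, Matrix.mulVec_smul] at h1
  rw [eq_inv_smul_iff₀ hc, h1]

/-- In a discrete group, a contraction towards a fixed point forces the other elements with the
same fixed point to share the second fixed point. -/
theorem area_eq_zero_of_contraction {Γ : Subgroup SL(2, ℝ)} (hΓ : DiscreteTopology Γ)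
    {u v : Fin 2 → ℝ} (huv : area u v ≠ 0) {g : SL(2, ℝ)} (hg : g ∈ Γ) {c : ℝ} (hc0 : c ≠ 0)
    (hc : |c| < 1) (hgu : g.1.mulVec u = c • u) (hgv : g.1.mulVec v = c⁻¹ • v)
    {h : SL(2, ℝ)} (hh : h ∈ Γ) (hhu : area u (h.1.mulVec u) = 0) :
    area v (h.1.mulVec v) = 0 := by
  obtain ⟨a, ha⟩ := (area_eq_zero_iff (left_ne_zero_of_area_ne_zero huv)).1 hhu
  obtain ⟨β, γ, hb⟩ := exists_eq_combination huv (h.1.mulVec v)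
  -- In the basis `u`, `v` the matrix of `h` is upper triangular with corner `β`, and conjugation by
  -- `g ^ k` multiplies the corner by `c ^ (2 * k)`. The conjugates converge, so by discreteness
  -- they are eventually constant, which forces `β = 0`.
  have hformula : ∀ k : ℕ, (g ^ k * h * (g ^ k)⁻¹).1 =
      basisMatrix u v (a • u) (((c ^ 2) ^ k * β) • u + γ • v) := by
    intro k
    have hck : c ^ k ≠ 0 := pow_ne_zero _ hc0
    have h1 : (g ^ k).1.mulVec u = c ^ k • u := pow_mulVec hgu k
    have h2 : (g ^ k).1.mulVec v = (c⁻¹) ^ k • v := pow_mulVec hgv k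
    have h3 := inv_mulVec hck h1
    have h4 := inv_mulVec (pow_ne_zero k (inv_ne_zero hc0)) h2
    refine matrix_ext_of_area_ne_zero huv ?_ ?_
    · rw [basisMatrix_left huv, Matrix.SpecialLinearGroup.coe_mul,
        Matrix.SpecialLinearGroup.coe_mul, ← Matrix.mulVec_mulVec, ← Matrix.mulVec_mulVec, h3,
        Matrix.mulVec_smul, Matrix.mulVec_smul, ha, Matrix.mulVec_smul, h1, smul_smul, smul_smul]
      congr 1
      field_simp
    · rw [basisMatrix_right huv, Matrix.SpecialLinearGroup.coe_mul,
        Matrix.SpecialLinearGroup.coe_mul, ← Matrix.mulVec_mulVec, ← Matrix.mulVec_mulVec, h4,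
        Matrix.mulVec_smul, Matrix.mulVec_smul, hb, Matrix.mulVec_add, Matrix.mulVec_smul,
        Matrix.mulVec_smul, h1, h2, smul_add, smul_smul, smul_smul, smul_smul, smul_smul]
      congr 2
      · rw [← inv_pow, inv_inv, pow_right_comm]; ring
      · rw [← inv_pow, inv_inv, inv_pow]; field_simp
  have hlim : Tendsto (fun k : ℕ => (g ^ k * h * (g ^ k)⁻¹).1) atTop
      (𝓝 (basisMatrix u v (a • u) (((0 : ℝ) * β) • u + γ • v))) := by
    simp_rw [hformula]
    refine ((continuous_basisMatrix u v (a • u)).tendsto _).comp ?_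
    have : Tendsto (fun k : ℕ => (c ^ 2) ^ k) atTop (𝓝 0) :=
      tendsto_pow_atTop_nhds_zero_of_lt_one (sq_nonneg c) (by
        rw [← sq_abs]; nlinarith [abs_nonneg c])
    exact ((this.mul_const β).smul_const u).add_const _
  obtain ⟨k, hk⟩ := (eventually_eq_of_tendsto hΓ
    (fun k => Γ.mul_mem (Γ.mul_mem (Γ.pow_mem hg k) hh) (Γ.inv_mem (Γ.pow_mem hg k))) hlim).exists
  have h5 := congrArg (fun M => M.mulVec v) (hk.symm.trans (hformula k))
  simp only [basisMatrix_right huv, add_left_inj] at h5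
  have h6 : ((c ^ 2) ^ k * β) • u = 0 := by rw [← h5]; simp
  rcases smul_eq_zero.1 h6 with h6 | h6
  · have hβ : β = 0 := (mul_eq_zero.1 h6).resolve_left (pow_ne_zero _ (pow_ne_zero _ hc0))
    rw [hb, hβ, zero_smul, zero_add, area_smul_right, area_self, mul_zero]
  · exact absurd h6 (left_ne_zero_of_area_ne_zero huv)

/-- A discrete group with a fixed point on the boundary has a finite limit set. -/
theorem finite_limitSet_of_fixed {Γ : Subgroup SL(2, ℝ)} (hΓ : DiscreteTopology Γ)
    {u : Fin 2 → ℝ} (hu : u ≠ 0) (h : ∀ g ∈ Γ, area u (g.1.mulVec u) = 0) :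
    (limitSet Γ).Finite := by
  -- Either every eigenvalue at `u` is `1` or `-1`, or some hyperbolic `g` fixes `u`; then, with `g`
  -- or its inverse as the contraction, the whole group also fixes the other fixed point of `g`.
  by_cases hpar : ∀ g ∈ Γ, ∀ c : ℝ, g.1.mulVec u = c • u → c ^ 2 = 1
  · refine finite_limitSet_of_parabolic hu fun g hg => ?_
    obtain ⟨c, hc⟩ := (area_eq_zero_iff hu).1 (h g hg)
    have h1 := hpar g hg c hc
    have h2 := eigenvalue_sq hu hc
    have h3 : g.1.trace = 2 * c := by
      have : c * (g.1.trace * c - 2) = 0 := by linear_combination -c * h2 + c * h1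
      have hc0 : c ≠ 0 := by rintro rfl; simp at h1
      have h4 := (mul_eq_zero.1 this).resolve_left hc0
      linear_combination c * h4 - g.1.trace * h1
    rw [hc, h3, smul_smul]
  · push Not at hpar
    obtain ⟨g, hg, c, hgu, hc⟩ := hpar
    have hc0 : c ≠ 0 := by
      have := eigenvalue_sq hu hgu
      rintro rfl; simp at this
    obtain ⟨v, huv, hgv⟩ := exists_second_eigenvector hu hgu hc
    refine finite_limitSet_of_pair huv fun f hf => Or.inl ⟨h f hf, ?_⟩
    rcases lt_trichotomy |c| 1 with hlt | heq | hgt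
    · exact area_eq_zero_of_contraction hΓ huv hg hc0 hlt hgu hgv hf (h f hf)
    · exact absurd (by rw [← sq_abs, heq, one_pow]) hc
    · refine area_eq_zero_of_contraction hΓ huv (Γ.inv_mem hg) (inv_ne_zero hc0) ?_
        (inv_mulVec hc0 hgu) (inv_mulVec (inv_ne_zero hc0) hgv) hf (h f hf)
      rw [abs_inv]
      exact inv_lt_one_of_one_lt₀ hgt

/-! ### Normal subgroups of torsion-free non-elementary groups -/

variable {G : Type*} [Group G] {ρ : G →* SL(2, ℝ)}

/-- Determinant one leaves only the scalars `1` and `-1`, so `g ^ 2 = 1`. -/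
theorem eq_one_of_scalar (hinj : Function.Injective ρ) (htf : ∀ g : G, IsOfFinOrder g → g = 1)
    {g : G} {c : ℝ} (h : (ρ g).1 = c • 1) : g = 1 := by
  have hd := (ρ g).2
  rw [h] at hd
  have hc : c ^ 2 = 1 := by simpa [Matrix.det_smul] using hd
  refine htf g (isOfFinOrder_iff_pow_eq_one.2 ⟨2, by norm_num, hinj ?_⟩)
  rw [map_pow, map_one]
  refine Subtype.ext ?_
  rw [Matrix.SpecialLinearGroup.coe_pow, h, smul_pow, hc, one_pow, one_smul,
    Matrix.SpecialLinearGroup.coe_one]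

/-- A non-trivial normal subgroup of a torsion-free non-elementary Fuchsian group has no fixed
point on the boundary. -/
theorem exists_area_ne_zero_of_normal (hinj : Function.Injective ρ)
    (hdisc : DiscreteTopology ρ.range) (htf : ∀ g : G, IsOfFinOrder g → g = 1)
    (hinf : (limitSet ρ.range).Infinite) {N : Subgroup G} [N.Normal] (hN : N ≠ ⊥)
    {u : Fin 2 → ℝ} (hu : u ≠ 0) : ∃ n ∈ N, area u ((ρ n).1.mulVec u) ≠ 0 := by
  by_contra! hfix
  obtain ⟨g, hg⟩ : ∃ g : G, area u ((ρ g).1.mulVec u) ≠ 0 := by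
    by_contra! hcon
    refine hinf (finite_limitSet_of_fixed hdisc hu ?_)
    rintro _ ⟨g, rfl⟩
    exact hcon g
  -- By normality, `G` permutes the boundary points fixed by all of `N`.
  have hmove : ∀ (h : G) (w : Fin 2 → ℝ), (∀ n ∈ N, area w ((ρ n).1.mulVec w) = 0) →
      ∀ n ∈ N, area ((ρ h).1.mulVec w) ((ρ n).1.mulVec ((ρ h).1.mulVec w)) = 0 := by
    intro h w hw n hn
    have h1 := hw (h⁻¹ * n * h) (by simpa using ‹N.Normal›.conj_mem n hn h⁻¹)
    rw [← area_mulVec (ρ h), Matrix.mulVec_mulVec, ← Matrix.SpecialLinearGroup.coe_mul,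
      ← map_mul] at h1
    rw [Matrix.mulVec_mulVec, ← Matrix.SpecialLinearGroup.coe_mul, ← map_mul]
    rwa [mul_assoc, mul_inv_cancel_left] at h1
  set v := (ρ g).1.mulVec u with hv
  have hv0 : v ≠ 0 := right_ne_zero_of_area_ne_zero hg
  have hfixv := hmove g u hfix
  obtain ⟨n, hn, hn1⟩ := N.ne_bot_iff_exists_ne_one.1 hN |>.elim fun n h =>
    (⟨n.1, n.2, fun h' => h (Subtype.ext h')⟩ : ∃ n, n ∈ N ∧ n ≠ 1)
  obtain ⟨l, hl⟩ := (area_eq_zero_iff hu).1 (hfix n hn)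
  obtain ⟨m, hm⟩ := (area_eq_zero_iff hv0).1 (hfixv n hn)
  have hlm : l ≠ m := by
    rintro rfl
    refine hn1 (eq_one_of_scalar hinj htf (c := l) (matrix_ext_of_area_ne_zero hg ?_ ?_))
    · rw [hl]; simp [Matrix.smul_mulVec]
    · rw [hm]; simp [Matrix.smul_mulVec]
  -- With different eigenvalues on `u` and `v`, `n` fixes no other boundary point. All of `G` then
  -- preserves the pair, which makes the limit set finite.
  have htwo : ∀ w, area w ((ρ n).1.mulVec w) = 0 → area u w = 0 ∨ area v w = 0 := by
    intro w hw
    obtain ⟨a, b, rfl⟩ := exists_eq_combination hg w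
    rw [Matrix.mulVec_add, Matrix.mulVec_smul, Matrix.mulVec_smul, hl, hm] at hw
    have h1 : a * b * (m - l) * area u v = 0 := by
      unfold area at *
      simp at hw
      linear_combination hw
    rw [area_add_right, area_smul_right, area_smul_right, area_self, area_add_right,
      area_smul_right, area_smul_right, area_self]
    rcases mul_eq_zero.1 h1 with h1 | h1
    · rcases mul_eq_zero.1 h1 with h1 | h1
      · rcases mul_eq_zero.1 h1 with h1 | h1
        · right; simp [h1]
        · left; simp [h1]
      · exact absurd (sub_eq_zero.1 h1).symm hlm
    · exact absurd h1 hg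
  refine hinf (finite_limitSet_of_pair hg ?_)
  rintro _ ⟨h, rfl⟩
  have hne : area ((ρ h).1.mulVec u) ((ρ h).1.mulVec v) ≠ 0 := by rwa [area_mulVec]
  have hpar : ∀ a b c : Fin 2 → ℝ, a ≠ 0 → area a b = 0 → area a c = 0 → area b c = 0 := by
    intro a b c ha h1 h2
    obtain ⟨x, rfl⟩ := (area_eq_zero_iff ha).1 h1
    obtain ⟨y, rfl⟩ := (area_eq_zero_iff ha).1 h2
    simp [area]; ring
  rcases htwo _ (hmove h u hfix n hn) with h1 | h1 <;>
  rcases htwo _ (hmove h v hfixv n hn) with h2 | h2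
  · exact absurd (hpar _ _ _ hu h1 h2) hne
  · exact Or.inl ⟨h1, h2⟩
  · exact Or.inr ⟨h1, h2⟩
  · exact absurd (hpar _ _ _ hv0 h1 h2) hne

/-- A non-trivial normal subgroup of a torsion-free non-elementary Fuchsian group has the same
limit set. -/
theorem limitSet_map_eq_of_normal (hinj : Function.Injective ρ)
    (hdisc : DiscreteTopology ρ.range) (htf : ∀ g : G, IsOfFinOrder g → g = 1)
    (hinf : (limitSet ρ.range).Infinite) {N : Subgroup G} [N.Normal] (hN : N ≠ ⊥) :
    limitSet (N.map ρ) = limitSet ρ.range := by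
  refine (limitSet_mono ?_).antisymm (limitSet_subset_of_normal ?_ ?_)
  · rintro _ ⟨g, -, rfl⟩
    exact ⟨g, rfl⟩
  · rintro _ ⟨g, rfl⟩ _ ⟨n, hn, rfl⟩
    exact ⟨g * n * g⁻¹, ‹N.Normal›.conj_mem n hn g, by simp⟩
  · intro u hu
    obtain ⟨n, hn, h⟩ := exists_area_ne_zero_of_normal hinj hdisc htf hinf hN hu
    exact ⟨ρ n, ⟨n, hn, rfl⟩, h⟩

/-- Non-trivial normal subgroups of a torsion-free non-elementary Fuchsian group meet
non-trivially. -/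
theorem inf_ne_bot_of_normal (hinj : Function.Injective ρ)
    (hdisc : DiscreteTopology ρ.range) (htf : ∀ g : G, IsOfFinOrder g → g = 1)
    (hinf : (limitSet ρ.range).Infinite) {N₁ N₂ : Subgroup G} [h₁ : N₁.Normal] [h₂ : N₂.Normal]
    (hN₁ : N₁ ≠ ⊥) (hN₂ : N₂ ≠ ⊥) : N₁ ⊓ N₂ ≠ ⊥ := by
  intro hbot
  obtain ⟨n, hn, hn1⟩ := N₁.ne_bot_iff_exists_ne_one.1 hN₁ |>.elim fun n h =>
    (⟨n.1, n.2, fun h' => h (Subtype.ext h')⟩ : ∃ n, n ∈ N₁ ∧ n ≠ 1)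
  -- Torsion-freeness excludes elliptic elements, so `n` has a real eigenvector.
  have htr : 4 ≤ (ρ n).1.trace ^ 2 := by
    by_contra! hlt
    have h := isOfFinOrder_of_trace_sq_lt hdisc ⟨n, rfl⟩ hlt
    exact hn1 (htf n (hinj.isOfFinOrder_iff.1 h))
  obtain ⟨u, hu, c, hc⟩ := exists_eigenvector htr
  obtain ⟨m, hm, hne⟩ := exists_area_ne_zero_of_normal hinj hdisc htf hinf hN₂ hu
  have hcomm : n * m = m * n :=
    Subgroup.commute_of_normal_of_disjoint N₁ N₂ h₁ h₂ (disjoint_iff.2 hbot) n m hn hm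
  -- Since `m` commutes with `n`, the vector `m u`, not parallel to `u`, has the same eigenvalue
  -- `c`.
  refine hn1 (eq_one_of_scalar hinj htf (c := c) (matrix_ext_of_area_ne_zero hne ?_ ?_))
  · rw [hc]; simp [Matrix.smul_mulVec]
  · rw [Matrix.mulVec_mulVec, ← Matrix.SpecialLinearGroup.coe_mul, ← map_mul, hcomm, map_mul,
      Matrix.SpecialLinearGroup.coe_mul, ← Matrix.mulVec_mulVec, hc, Matrix.mulVec_smul]
    simp [Matrix.smul_mulVec]

theorem iInf_ne_bot_of_normal (hinj : Function.Injective ρ)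
    (hdisc : DiscreteTopology ρ.range) (htf : ∀ g : G, IsOfFinOrder g → g = 1)
    (hinf : (limitSet ρ.range).Infinite) {ι : Type*} [Finite ι] (N : ι → Subgroup G)
    [hnor : ∀ i, (N i).Normal] (hN : ∀ i, N i ≠ ⊥) : ⨅ i, N i ≠ ⊥ := by
  have := Fintype.ofFinite ι
  have key : ∀ s : Finset ι, (⨅ i ∈ s, N i) ≠ ⊥ ∧ (⨅ i ∈ s, N i).Normal := by
    classical
    intro s
    induction s using Finset.induction_on with
    | empty =>
      simp only [Finset.notMem_empty, iInf_false, iInf_top]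
      refine ⟨fun h => ?_, inferInstance⟩
      -- The empty intersection is all of `G`; if `G` were trivial it would fix a boundary point and
      -- have a finite limit set.
      refine hinf (finite_limitSet_of_fixed hdisc (u := ![1, 0])
        (fun h => by simpa using congrFun h 0) ?_)
      rintro _ ⟨g, rfl⟩
      have hg : g = 1 := Subgroup.mem_bot.1 (h ▸ Subgroup.mem_top g)
      rw [hg, map_one]
      simp [area_self]
    | insert i s _ ih =>
      obtain ⟨ih1, ih2⟩ := ih
      rw [Finset.iInf_insert]
      exact ⟨inf_ne_bot_of_normal hinj hdisc htf hinf (hN i) ih1, inferInstance⟩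
  simpa using (key Finset.univ).1

end Fuchsian

/-! ### Almost normal subgroups -/

/-- A group that embeds in `ℤ ^ d` is commutative. -/
theorem commute_of_injective_to_int {D : Type*} [Group D] {d : ℕ}
    (Φ : D →* Multiplicative (Fin d → ℤ)) (hΦ : Function.Injective Φ) (a b : D) :
    a * b = b * a := hΦ (by rw [map_mul, map_mul, mul_comm])

/-- A group that embeds in `ℤ ^ d` is finitely generated. -/
theorem fg_of_injective_to_int {D : Type*} [Group D] {d : ℕ}
    (Φ : D →* Multiplicative (Fin d → ℤ)) (hΦ : Function.Injective Φ) : Group.FG D := by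
  have h1 : AddGroup.FG (MonoidHom.toAdditiveLeft Φ).range := by
    rw [AddGroup.fg_iff_addSubgroup_fg, ← AddSubgroup.toIntSubmodule_toAddSubgroup
      (MonoidHom.toAdditiveLeft Φ).range, ← Submodule.fg_iff_addSubgroup_fg]
    exact IsNoetherian.noetherian _
  have e : (MonoidHom.toAdditiveLeft Φ).range ≃+ Additive D :=
    (AddMonoidHom.ofInjective (f := MonoidHom.toAdditiveLeft Φ) hΦ).symm
  rw [GroupFG.iff_add_fg]
  exact AddGroup.fg_of_surjective (f := e.toAddMonoidHom) e.surjective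

open scoped Pointwise in
/-- A finitely generated commutative subgroup of finite index in a normal subgroup is normalized
by a subgroup of finite index. -/
theorem exists_finiteIndex_normalizing {A : Type*} [Group A] {T D : Subgroup A} [T.Normal]
    (hDT : D ≤ T) (hfin : D.relIndex T ≠ 0) (hcomm : ∀ a b : D, a * b = b * a)
    (hfg : Group.FG D) :
    ∃ N : Subgroup A, N.FiniteIndex ∧ ∀ g ∈ N, ∀ x ∈ D, g * x * g⁻¹ ∈ D := by
  set m := D.relIndex T with hm
  -- `P` lies in every subgroup whose relative index in `T` is `m`, in particular in every conjugate
  -- of `D`, because `T` is normal.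
  set P : Subgroup A := Subgroup.closure {x | ∃ t ∈ T, x = t ^ m.factorial} with hP
  have hPle : ∀ H : Subgroup A, H.relIndex T = m → P ≤ H := by
    intro H hH
    rw [hP, Subgroup.closure_le]
    rintro _ ⟨t, ht, rfl⟩
    refine (Subgroup.pow_mem_of_relIndex_ne_zero_of_dvd (hH ▸ hfin) ht fun k hk hk' => ?_).1
    exact Nat.dvd_factorial hk (hH ▸ hk')
  have hPD : P ≤ D := hPle D rfl
  -- The quotient of `D` by `P` is finitely generated, abelian and torsion, hence finite.
  have hPDfin : P.relIndex D ≠ 0 := by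
    let _ : CommGroup D := { (inferInstance : Group D) with mul_comm := hcomm }
    have : Group.FG (D ⧸ P.subgroupOf D) :=
      Group.fg_of_surjective (f := QuotientGroup.mk' (P.subgroupOf D))
        (QuotientGroup.mk'_surjective _)
    have htors : IsMulTorsion (D ⧸ P.subgroupOf D) := by
      intro x
      obtain ⟨y, rfl⟩ := QuotientGroup.mk_surjective x
      refine isOfFinOrder_iff_pow_eq_one.2 ⟨m.factorial, m.factorial_pos, ?_⟩
      rw [← QuotientGroup.mk_pow, QuotientGroup.eq_one_iff, Subgroup.mem_subgroupOf]
      exact Subgroup.subset_closure ⟨y, hDT y.2, rfl⟩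
    have : Finite (D ⧸ P.subgroupOf D) := CommGroup.finite_of_fg_isMulTorsion _ htors
    have : (P.subgroupOf D).FiniteIndex := Subgroup.finiteIndex_of_finite_quotient
    exact this.index_ne_zero
  have hPT : P ≤ T := hPD.trans hDT
  have hPTfin : P.relIndex T ≠ 0 := by
    rw [← Subgroup.relIndex_mul_relIndex P D T hPD hDT]
    exact mul_ne_zero hPDfin hfin
  -- An intermediate subgroup is a union of cosets of `P` in `T`, of which there are finitely many.
  -- So `D` has finitely many conjugates, and its stabilizer under conjugation has finite index.
  have hS : {H : Subgroup A | P ≤ H ∧ H ≤ T}.Finite := by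
    have : (P.subgroupOf T).FiniteIndex := ⟨hPTfin⟩
    have : Finite (T ⧸ P.subgroupOf T) := inferInstance
    refine Set.Finite.of_finite_image (f := fun H : Subgroup A =>
      (QuotientGroup.mk (s := P.subgroupOf T)) '' (H.subgroupOf T : Set T)) (Set.toFinite _) ?_
    have key : ∀ H K : Subgroup A, P ≤ K → H ≤ T →
        (QuotientGroup.mk (s := P.subgroupOf T)) '' (H.subgroupOf T : Set T) ⊆
        (QuotientGroup.mk (s := P.subgroupOf T)) '' (K.subgroupOf T : Set T) → H ≤ K := by
      intro H K hK hH hsub x hx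
      obtain ⟨y, hy, hxy⟩ := hsub ⟨⟨x, hH hx⟩, hx, rfl⟩
      have h1 : (y : A)⁻¹ * x ∈ K := hK (Subgroup.mem_subgroupOf.1 (QuotientGroup.eq.1 hxy))
      have h2 : (y : A) ∈ K := hy
      simpa using K.mul_mem h2 h1
    intro H hH K hK heq
    exact le_antisymm (key H K hK.1 hH.2 heq.le) (key K H hH.1 hK.2 heq.ge)
  have horb : (MulAction.orbit (ConjAct A) D).Finite := by
    refine hS.subset ?_
    rintro _ ⟨g, rfl⟩
    have hT : g • T = T := Subgroup.Normal.conjAct ‹T.Normal› g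
    refine ⟨hPle _ ?_, ?_⟩
    · change (g • D).relIndex T = m
      conv_lhs => rw [← hT]
      rw [Subgroup.relIndex_pointwise_smul]
    · change g • D ≤ T
      rw [← hT]
      exact Subgroup.pointwise_smul_le_pointwise_smul_iff.2 hDT
  refine ⟨(MulAction.stabilizer (ConjAct A) D).comap
    (ConjAct.toConjAct (G := A)).toMonoidHom, ⟨?_⟩, ?_⟩
  · rw [Subgroup.index_comap_of_surjective _ (show Function.Surjective
      (ConjAct.toConjAct (G := A)).toMonoidHom from ConjAct.toConjAct.surjective),
      MulAction.index_stabilizer]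
    exact (Set.ncard_pos horb).2 (MulAction.nonempty_orbit D) |>.ne'
  · intro g hg x hx
    have h1 : ConjAct.toConjAct g • D = D := hg
    have h2 := Subgroup.smul_mem_pointwise_smul x (ConjAct.toConjAct g) D hx
    rwa [h1, ConjAct.toConjAct_smul] at h2

/-! ### Translation automorphisms -/

/-- The punctured disc is the image of a half-plane under `exp`. -/
theorem isPreconnected_punctured_ball {r : ℝ} (hr : 0 < r) :
    IsPreconnected (Metric.ball (0 : ℂ) r \ {0}) := by
  have h : Complex.exp '' {z | z.re < Real.log r} = Metric.ball (0 : ℂ) r \ {0} := by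
    ext z
    constructor
    · rintro ⟨y, hy, rfl⟩
      refine ⟨?_, Complex.exp_ne_zero y⟩
      rw [mem_ball_zero_iff, Complex.norm_exp]
      exact (Real.lt_log_iff_exp_lt hr).1 hy
    · rintro ⟨h1, h2⟩
      refine ⟨Complex.log z, ?_, Complex.exp_log h2⟩
      rw [mem_ball_zero_iff] at h1
      change (Complex.log z).re < _
      rw [Complex.log_re]
      exact Real.log_lt_log (norm_pos_iff.2 h2) h1
  rw [← h]
  exact (convex_halfSpace_re_lt _).isPreconnected.image _ Complex.continuous_exp.continuousOn

namespace TranslationSurface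

variable {S : Type*} [TopologicalSpace S] {X : TranslationSurface S}

theorem exists_ball_of_mem_nhds {w : OpenPartialHomeomorph S ℂ} {x : S} (hx : x ∈ w.source)
    (hw : w x = 0) {V : Set S} (hV : V ∈ 𝓝 x) :
    ∃ r > 0, Metric.ball 0 r ⊆ w.target ∧ ∀ ζ ∈ Metric.ball (0 : ℂ) r, w.symm ζ ∈ V := by
  have h0 : (0 : ℂ) ∈ w.target := hw ▸ w.map_source hx
  have hx' : w.symm 0 = x := by rw [← hw, w.left_inv hx]
  have h1 : w.symm ⁻¹' V ∈ 𝓝 (0 : ℂ) :=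
    (w.continuousAt_symm h0).preimage_mem_nhds (by rwa [hx'])
  obtain ⟨r, hr, hsub⟩ := Metric.mem_nhds_iff.1 (inter_mem (w.open_target.mem_nhds h0) h1)
  exact ⟨r, hr, fun ζ hζ => (hsub hζ).1, fun ζ hζ => (hsub hζ).2⟩

theorem symm_image_ball_mem_nhds {w : OpenPartialHomeomorph S ℂ} {x : S} (hx : x ∈ w.source)
    (hw : w x = 0) {r : ℝ} (hr : 0 < r) :
    ∀ᶠ y in 𝓝 x, y ∈ w.source ∧ w y ∈ Metric.ball (0 : ℂ) r :=
  (w.open_source.eventually_mem hx).and ((w.continuousAt hx).eventually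
    (hw ▸ Metric.ball_mem_nhds _ hr))

/-- A translation automorphism is the identity near a regular fixed point. -/
theorem IsAffine.eventually_eq_of_fixed {t : S ≃ₜ S} (ht : X.IsAffine t 1) {x : S}
    (hx : x ∉ X.sing) (hfix : t x = x) : ∀ᶠ y in 𝓝 x, t y = y := by
  obtain ⟨φ, hφ, hxφ⟩ := X.exists_chart x hx
  obtain ⟨c, hc⟩ := ht.2 φ hφ φ hφ x hxφ (by rwa [hfix])
  have h0 := hc.self_of_nhds
  rw [planeAct_one, hfix] at h0
  have hc0 : c = 0 := by linear_combination -h0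
  have hcont : Tendsto t (𝓝 x) (𝓝 x) := by
    have := t.continuous.tendsto x
    rwa [hfix] at this
  filter_upwards [hc, φ.open_source.mem_nhds hxφ,
    hcont.eventually (φ.open_source.mem_nhds hxφ)] with y hy hy1 hy2
  rw [planeAct_one, hc0, add_zero] at hy
  exact φ.injOn hy2 hy1 hy

theorem notMem_sing_of_mem_source {w : OpenPartialHomeomorph S ℂ} {x : S}
    (hws : w.source ∩ X.sing = {x}) (hw : w x = 0) {ζ : ℂ} (hζ : ζ ∈ w.target) (h0 : ζ ≠ 0) :
    w.symm ζ ∉ X.sing := by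
  intro h
  have : w.symm ζ ∈ w.source ∩ X.sing := ⟨w.map_target hζ, h⟩
  rw [hws] at this
  apply h0
  rw [← w.right_inv hζ, this, hw]

/-- Near a fixed cone point, a translation automorphism multiplies the cone coordinate by
roots of unity. -/
theorem IsAffine.eventually_pow_eq {t : S ≃ₜ S} (ht : X.IsAffine t 1) {x : S} (hfix : t x = x)
    {w : OpenPartialHomeomorph S ℂ} {k : ℕ} (hx : x ∈ w.source) (hw0 : w x = 0)
    (hws : w.source ∩ X.sing = {x})
    (hw : ∀ φ ∈ X.charts, ∀ y, y ∈ w.source → y ∈ φ.source →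
      ∃ c : ℂ, ∀ᶠ z in 𝓝 y, φ z = (w z) ^ k + c) :
    ∀ᶠ y in 𝓝 x, t y ∈ w.source ∧ w (t y) ^ k = w y ^ k := by
  have hcont : Tendsto t (𝓝 x) (𝓝 x) := by
    have := t.continuous.tendsto x
    rwa [hfix] at this
  have hV : t ⁻¹' w.source ∈ 𝓝 x := hcont (w.open_source.mem_nhds hx)
  obtain ⟨r, hr, hsub, hrV⟩ := exists_ball_of_mem_nhds hx hw0 hV
  set q : ℂ → ℂ := fun ζ => w (t (w.symm ζ)) ^ k - ζ ^ k with hq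
  -- In charts `t` is a translation and the charts are `w ^ k` up to constants, so `q` is locally
  -- constant on the punctured disc. By connectedness it is constant there, and continuity at the
  -- centre makes it `0`.
  have hlocal : ∀ ζ ∈ Metric.ball (0 : ℂ) r \ {0}, ∀ᶠ ξ in 𝓝 ζ, q ξ = q ζ := by
    rintro ζ ⟨hζ, hζ0⟩
    have hζt := hsub hζ
    have hreg := notMem_sing_of_mem_source hws hw0 hζt hζ0
    obtain ⟨φ, hφ, hyφ⟩ := X.exists_chart _ hreg
    obtain ⟨ψ, hψ, hyψ⟩ := X.exists_chart (t (w.symm ζ)) (fun h => hreg ((ht.1 _).1 h))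
    obtain ⟨c, hc⟩ := ht.2 φ hφ ψ hψ _ hyφ hyψ
    obtain ⟨c₁, hc₁⟩ := hw φ hφ _ (w.map_target hζt) hyφ
    obtain ⟨c₂, hc₂⟩ := hw ψ hψ _ (hrV ζ hζ) hyψ
    have hev : ∀ᶠ ξ in 𝓝 ζ, q ξ = c + c₁ - c₂ := by
      have hs := w.continuousAt_symm hζt
      filter_upwards [hs.eventually hc, hs.eventually hc₁,
        hs.eventually (t.continuous.continuousAt.eventually hc₂),
        w.open_target.mem_nhds hζt] with ξ h1 h2 h3 h4
      rw [planeAct_one] at h1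
      rw [w.right_inv h4] at h2
      simp only [hq]
      linear_combination h1 - h3 + h2
    filter_upwards [hev] with ξ hξ
    rw [hξ, hev.self_of_nhds]
  have hconst : ∀ ζ ∈ Metric.ball (0 : ℂ) r \ {0}, ∀ ξ ∈ Metric.ball (0 : ℂ) r \ {0},
      q ζ = q ξ := by
    intro ζ hζ ξ hξ
    exact (isPreconnected_punctured_ball hr).induction₂ (fun a b => q a = q b)
      (fun a ha => ((hlocal a ha).filter_mono nhdsWithin_le_nhds).mono fun _ h => h.symm)
      (fun a b c _ _ _ h1 h2 => h1.trans h2) (fun a b _ _ h => h.symm) hζ hξ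
  have h0t : (0 : ℂ) ∈ w.target := hsub (Metric.mem_ball_self hr)
  have hsymm0 : w.symm 0 = x := by rw [← hw0, w.left_inv hx]
  have hq0 : q 0 = 0 := by
    simp [hq, hsymm0, hfix, hw0]
  have hqcont : ContinuousAt q 0 := by
    have h1 : ContinuousAt w.symm 0 := w.continuousAt_symm h0t
    have h2 : ContinuousAt (fun ζ => t (w.symm ζ)) 0 := t.continuous.continuousAt.comp h1
    have h3 : ContinuousAt (fun ζ => w (t (w.symm ζ))) 0 :=
      ContinuousAt.comp (f := fun ζ => t (w.symm ζ)) (g := w)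
        (by rw [hsymm0, hfix]; exact w.continuousAt hx) h2
    exact (h3.pow k).sub (continuousAt_id.pow k)
  have hzero : ∀ ζ ∈ Metric.ball (0 : ℂ) r, q ζ = 0 := by
    intro ζ hζ
    by_cases hζ0 : ζ = 0
    · rw [hζ0, hq0]
    · have h1 : Tendsto q (𝓝[≠] 0) (𝓝 (q 0)) := hqcont.tendsto.mono_left nhdsWithin_le_nhds
      have h2 : Tendsto q (𝓝[≠] 0) (𝓝 (q ζ)) := by
        refine tendsto_const_nhds.congr' ?_
        filter_upwards [self_mem_nhdsWithin, nhdsWithin_le_nhds (Metric.ball_mem_nhds _ hr)]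
          with ξ h3 h4
        exact hconst ζ ⟨hζ, hζ0⟩ ξ ⟨h4, h3⟩
      rw [tendsto_nhds_unique h2 h1, hq0]
  filter_upwards [symm_image_ball_mem_nhds hx hw0 hr, hV] with y hy hyV
  refine ⟨hyV, ?_⟩
  have := hzero _ hy.2
  simp only [hq, w.left_inv hy.1] at this
  exact sub_eq_zero.1 this

/-- Only a limit at a cone point needs an argument: in the punctured cone neighbourhood the fixed
points form a relatively clopen set, which is non-empty and hence everything. -/
theorem IsAffine.isClosed_eventually_fixed [T2Space S] {t : S ≃ₜ S} (ht : X.IsAffine t 1) :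
    IsClosed {x | ∀ᶠ y in 𝓝 x, t y = y} := by
  rw [← closure_subset_iff_isClosed]
  intro x hx
  have hfixcl : IsClosed {y | t y = y} := isClosed_eq t.continuous continuous_id
  have hxfix : t x = x := by
    refine closure_minimal (t := {y | t y = y}) (fun y hy => ?_) hfixcl hx
    exact Eventually.self_of_nhds (p := fun z => t z = z) hy
  by_cases hsing : x ∈ X.sing
  · obtain ⟨k, hk, w, hxw, hw0, hws, hw⟩ := X.cone x hsing
    obtain ⟨r, hr, hsub, -⟩ := exists_ball_of_mem_nhds hxw hw0 univ_mem
    have hnear := symm_image_ball_mem_nhds hxw hw0 hr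
    obtain ⟨y, ⟨hyw, hyr⟩, hy⟩ := mem_closure_iff_nhds.1 hx _ hnear
    by_cases hyx : y = x
    · exact hyx ▸ hy
    have hy0 : w y ≠ 0 := fun h => hyx (w.injOn hyw hxw (h.trans hw0.symm))
    have hall : ∀ ζ ∈ Metric.ball (0 : ℂ) r \ {0}, t (w.symm ζ) = w.symm ζ := by
      intro ζ hζ
      have := (isPreconnected_punctured_ball hr).induction₂
        (fun a b => t (w.symm a) = w.symm a ↔ t (w.symm b) = w.symm b) ?_
        (fun a b c _ _ _ h1 h2 => h1.trans h2) (fun a b _ _ h => h.symm) ⟨hyr, hy0⟩ hζ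
      · rw [← this, w.left_inv hyw]
        exact Eventually.self_of_nhds (p := fun z => t z = z) hy
      · rintro a ⟨ha, ha0⟩
        refine Eventually.filter_mono nhdsWithin_le_nhds ?_
        have hs := w.continuousAt_symm (hsub ha)
        by_cases hfix : t (w.symm a) = w.symm a
        · filter_upwards [hs.eventually (ht.eventually_eq_of_fixed
            (notMem_sing_of_mem_source hws hw0 (hsub ha) ha0) hfix)] with b hb
          exact iff_of_true hfix hb
        · filter_upwards [hs.eventually (hfixcl.isOpen_compl.mem_nhds hfix)] with b hb
          exact iff_of_false hfix hb
    change ∀ᶠ y in 𝓝 x, t y = y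
    filter_upwards [hnear] with z hz
    by_cases hz0 : w z = 0
    · rw [w.injOn hz.1 hxw (hz0.trans hw0.symm), hxfix]
    · have := hall _ ⟨hz.2, hz0⟩
      rwa [w.left_inv hz.1] at this
  · exact ht.eventually_eq_of_fixed hsing hxfix

/-- A translation automorphism with a regular fixed point is the identity. -/
theorem IsAffine.eq_one_of_fixed [T2Space S] [PreconnectedSpace S] {t : S ≃ₜ S}
    (ht : X.IsAffine t 1) {x : S} (hx : x ∉ X.sing) (hfix : t x = x) : t = 1 := by
  have hopen : IsOpen {x | ∀ᶠ y in 𝓝 x, t y = y} := isOpen_setOfPred_eventually_nhds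
  have huniv : {x | ∀ᶠ y in 𝓝 x, t y = y} = univ :=
    IsClopen.eq_univ ⟨ht.isClosed_eventually_fixed, hopen⟩ ⟨x, ht.eventually_eq_of_fixed hx hfix⟩
  ext y
  have : y ∈ {x | ∀ᶠ y in 𝓝 x, t y = y} := huniv ▸ mem_univ y
  exact Eventually.self_of_nhds (p := fun z => t z = z) this

/-- Two translation automorphisms that agree at a regular point are equal. -/
theorem IsAffine.eq_of_apply_eq [T2Space S] [PreconnectedSpace S] {s t : S ≃ₜ S}
    (hs : X.IsAffine s 1) (ht : X.IsAffine t 1) {x : S} (hx : x ∉ X.sing) (h : s x = t x) :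
    s = t := by
  have h1 : X.IsAffine (t⁻¹ * s) 1 := by simpa using ht.inv.mul hs
  have h2 : (t⁻¹ * s) x = x := by
    change t.symm (s x) = x
    rw [h, t.symm_apply_apply]
  exact (inv_mul_eq_one.1 (h1.eq_one_of_fixed hx h2)).symm

/-- The translation automorphisms that fix a given singularity form a finite set. -/
theorem finite_setOf_isAffine_one_fixed [T2Space S] [PreconnectedSpace S] {x : S}
    (hx : x ∈ X.sing) : {t : S ≃ₜ S | X.IsAffine t 1 ∧ t x = x}.Finite := by
  obtain ⟨k, hk, w, hxw, hw0, hws, hw⟩ := X.cone x hx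
  by_contra hinf
  obtain ⟨F, hF, hcard⟩ := Set.Infinite.exists_subset_card_eq hinf (k + 1)
  have hev : ∀ᶠ y in 𝓝 x, ∀ t ∈ F, t y ∈ w.source ∧ w (t y) ^ k = w y ^ k :=
    (Filter.eventually_all_finset F).2 fun t ht =>
      (hF ht).1.eventually_pow_eq (hF ht).2 hxw hw0 hws hw
  obtain ⟨r, hr, hsub, hrV⟩ := exists_ball_of_mem_nhds hxw hw0 hev
  set ζ : ℂ := ((r / 2 : ℝ) : ℂ) with hζdef
  have hζ : ζ ∈ Metric.ball (0 : ℂ) r := by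
    rw [mem_ball_zero_iff, hζdef, Complex.norm_real, Real.norm_eq_abs, abs_of_pos (by linarith)]
    linarith
  have hζ0 : ζ ≠ 0 := by
    rw [hζdef]; exact_mod_cast (by linarith : r / 2 ≠ 0)
  have hreg := notMem_sing_of_mem_source hws hw0 (hsub hζ) hζ0
  have hroots := hrV ζ hζ
  classical
  -- Different translations send the chosen regular point to different points, whose `w`-coordinates
  -- are all `k`-th roots of one number; there are at most `k` of them.
  have hle : F.card ≤ (Polynomial.nthRoots k (w (w.symm ζ) ^ k)).toFinset.card := by
    refine Finset.card_le_card_of_injOn (fun t => w (t (w.symm ζ))) ?_ ?_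
    · intro t ht
      simp only [Finset.mem_coe, Multiset.mem_toFinset]
      exact (Polynomial.mem_nthRoots hk).2 (hroots t ht).2
    · intro s hs t ht hst
      exact (hF hs).1.eq_of_apply_eq (hF ht).1 hreg
        (w.injOn (hroots s hs).1 (hroots t ht).1 hst)
  have := hle.trans ((Multiset.toFinset_card_le _).trans (Polynomial.card_nthRoots k _))
  omega

/-- A compact translation surface has finitely many singularities. -/
theorem finite_sing [CompactSpace S] (X : TranslationSurface S) : X.sing.Finite := by
  have hclosed : IsClosed X.sing := by
    rw [← isOpen_compl_iff, isOpen_iff_mem_nhds]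
    intro x hx
    obtain ⟨φ, hφ, hxφ⟩ := X.exists_chart x hx
    exact mem_of_superset (φ.open_source.mem_nhds hxφ)
      (disjoint_left.1 (X.disjoint_sing φ hφ))
  refine hclosed.isCompact.finite ?_
  rw [isDiscrete_iff_forall_mem_exists_isOpen]
  intro x hx
  obtain ⟨k, hk, w, hxw, hw0, hws, hw⟩ := X.cone x hx
  exact ⟨w.source, w.open_source, by rw [hws]⟩

/-- A torsion-free group of affine automorphisms of a compact surface is determined by its linear
parts. -/
theorem linearPart_injective [CompactSpace S] [T2Space S] [PreconnectedSpace S]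
    (hsing : X.sing.Nonempty) {G : Subgroup X.affineGroup}
    (hG : ∀ g : G, IsOfFinOrder g → g = 1) : Function.Injective (linearPart G) := by
  rw [injective_iff_map_eq_one]
  intro g hg
  obtain ⟨x, hx⟩ := hsing
  have haff : ∀ n : ℕ, X.IsAffine (g ^ n).1.1.1 1 := by
    intro n
    have h1 : X.IsAffine (g ^ n).1.1.1 (g ^ n).1.1.2 := (g ^ n).1.2
    have h2 : linearPart G (g ^ n) = 1 := by rw [map_pow, hg, one_pow]
    exact (show (g ^ n).1.1.2 = 1 from h2) ▸ h1
  have hlin : ∀ n : ℕ, (g ^ n).1.1.2 = 1 := fun n => by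
    have h2 : linearPart G (g ^ n) = 1 := by rw [map_pow, hg, one_pow]
    exact h2
  have hfin := X.finite_sing
  have hfin' := finite_setOf_isAffine_one_fixed hx
  have hadd : ∀ m n : ℕ, ∀ y, (g ^ (m + n)).1.1.1 y = (g ^ m).1.1.1 ((g ^ n).1.1.1 y) := by
    intro m n y
    rw [pow_add]; rfl
  -- The orbit of `x` stays in the finite singular set, so a positive power of `g` fixes `x`. The
  -- powers of that power range over a finite set, and `g` has finite order.
  obtain ⟨a, ha, hax⟩ : ∃ a : ℕ, 0 < a ∧ (g ^ a).1.1.1 x = x := by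
    have hmaps : MapsTo (fun n : ℕ => (g ^ n).1.1.1 x) univ X.sing :=
      fun n _ => ((haff n).1 x).2 hx
    obtain ⟨m, -, n, -, hne, heq⟩ := infinite_univ.exists_ne_map_eq_of_mapsTo hmaps hfin
    wlog hlt : m < n generalizing m n
    · exact this n m hne.symm heq.symm (lt_of_le_of_ne (not_lt.1 hlt) hne.symm)
    refine ⟨n - m, by omega, (g ^ m).1.1.1.injective ?_⟩
    rw [← hadd, Nat.add_sub_cancel' hlt.le]
    exact heq.symm
  have hmaps : MapsTo (fun n : ℕ => (g ^ (a * n)).1.1.1) univ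
      {t : S ≃ₜ S | X.IsAffine t 1 ∧ t x = x} := by
    intro n hn
    refine ⟨haff _, ?_⟩
    clear hn
    induction n with
    | zero => simp
    | succ n ih =>
      change (g ^ (a * (n + 1))).1.1.1 x = x
      rw [mul_add, mul_one, hadd, hax]
      exact ih
  obtain ⟨m, -, n, -, hne, heq⟩ := infinite_univ.exists_ne_map_eq_of_mapsTo hmaps hfin'
  have hpow : g ^ (a * m) = g ^ (a * n) :=
    Subtype.ext (Subtype.ext (Prod.ext heq ((hlin _).trans (hlin _).symm)))
  by_contra hne1
  refine hne (Nat.eq_of_mul_eq_mul_left ha ?_)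
  exact injective_pow_iff_not_isOfFinOrder.2 (fun h => hne1 (hG g h)) hpow

end TranslationSurface

/-! ### Singular cocycles along paths -/

/-- `δ` runs back along `γ` and then along `γ'`. It is the third edge of a singular triangle with
the other two edges `γ` and `γ'`, so the cocycle identity gives the formula for all `p` and `c` at
once. -/
theorem exists_wedge {E : Type*} [TopologicalSpace E] (γ γ' : C(I, E)) (h : γ 0 = γ' 0) :
    ∃ δ : C(I, E), δ 0 = γ 1 ∧ δ 1 = γ' 1 ∧
      ∀ {S : Type*} [TopologicalSpace S] (p : C(E, S)) (c : singularCocycles ℤ S),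
        c.1 (p.comp δ) = c.1 (p.comp γ') - c.1 (p.comp γ) := by
  -- The triangle is collapsed to `[-1, 1]` by `x ↦ x 2 - x 1`; its edges `01`, `02`, `12` become
  -- `0` to `-1`, `0` to `1` and `-1` to `1`.
  let L : C(ℝ, E) :=
    { toFun := fun r => if r ≤ 0 then γ (projIcc 0 1 zero_le_one (-r))
        else γ' (projIcc 0 1 zero_le_one r)
      continuous_toFun := by
        refine Continuous.if_le (by fun_prop) (by fun_prop) continuous_id continuous_const ?_
        rintro r rfl
        simp only [neg_zero, projIcc_left]
        exact h }
  let s : C(stdSimplex ℝ (Fin 3), E) :=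
    ⟨fun x => L (x.1 2 - x.1 1), L.continuous.comp
      (((continuous_apply 2).comp continuous_subtype_val).sub
        ((continuous_apply 1).comp continuous_subtype_val))⟩
  have h01 : s.comp (simplexEdge 0 1) = γ := by
    ext t
    simp [s, L, simplexEdge, t.2.1]
  have h02 : s.comp (simplexEdge 0 2) = γ' := by
    ext t
    by_cases ht : t.1 ≤ 0
    · have ht0 : t = 0 := le_antisymm ht t.2.1
      simp [s, L, simplexEdge, ht0, h]
    · simp [s, L, simplexEdge, ht]
  refine ⟨s.comp (simplexEdge 1 2), ?_, ?_, fun p c => ?_⟩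
  · simp [s, L, simplexEdge]
  · simp [s, L, simplexEdge]
  · have := c.2 (p.comp s)
    rw [ContinuousMap.comp_assoc, ContinuousMap.comp_assoc, ContinuousMap.comp_assoc, h01, h02]
      at this
    linarith

theorem singularCocycles_const {S : Type*} [TopologicalSpace S] (c : singularCocycles ℤ S)
    (x : S) : c.1 (ContinuousMap.const I x) = 0 := by
  have := c.2 (ContinuousMap.const _ x)
  simpa using this

/-- A wedge with a constant path reverses `γ`; a wedge of the reversed path with `γ'` concatenates.
-/
theorem exists_concat {E : Type*} [TopologicalSpace E] (γ γ' : C(I, E)) (h : γ 1 = γ' 0) :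
    ∃ δ : C(I, E), δ 0 = γ 0 ∧ δ 1 = γ' 1 ∧
      ∀ {S : Type*} [TopologicalSpace S] (p : C(E, S)) (c : singularCocycles ℤ S),
        c.1 (p.comp δ) = c.1 (p.comp γ) + c.1 (p.comp γ') := by
  obtain ⟨r, hr0, hr1, hr⟩ := exists_wedge γ (ContinuousMap.const I (γ 0)) rfl
  obtain ⟨δ, h0, h1, hδ⟩ := exists_wedge r γ' (hr0.trans h)
  refine ⟨δ, h0.trans hr1, h1, fun p c => ?_⟩
  rw [hδ, hr, show p.comp (ContinuousMap.const I (γ 0)) = ContinuousMap.const I (p (γ 0)) from rfl,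
    singularCocycles_const]
  ring

/-! ### Lifting to the cover -/

namespace IsCoverDefinedBy

variable {S E : Type*} [TopologicalSpace S] [TopologicalSpace E] {ι : Type*}
  {f : ι → SingularH1 ℤ S} {p : C(E, S)}

/-- The wedge of the two paths projects to a loop, whose periods are the differences of the cocycle
values. This replaces the defining condition on loops by a comparison of paths. -/
theorem eq_iff_of_lifts (hp : IsCoverDefinedBy f p) {c : ι → singularCocycles ℤ S}
    (hc : ∀ i, Submodule.Quotient.mk (c i) = f i) {γ γ' : C(I, E)} (h0 : γ 0 = γ' 0)
    (h1 : p (γ 1) = p (γ' 1)) :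
    γ 1 = γ' 1 ↔ ∀ i, (c i).1 (p.comp γ) = (c i).1 (p.comp γ') := by
  obtain ⟨δ, hδ0, hδ1, hδ⟩ := exists_wedge γ γ' h0
  have hclosed : p (δ 0) = p (δ 1) := by rw [hδ0, hδ1, h1]
  have key := hp.closed_iff δ hclosed
  rw [hδ0, hδ1] at key
  rw [key]
  refine forall_congr' fun i => ?_
  have : SingularH1.period ℤ (p.comp δ) hclosed (f i) = (c i).1 (p.comp δ) := by
    rw [← hc i]; rfl
  rw [this, hδ, sub_eq_zero, eq_comm]

/-- A map that fixes the real classes of the `f i` does not change the differences of the cocycles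
along paths with common endpoints. -/
theorem cocycle_comp_sub {f : SingularH1 ℤ S} {c : singularCocycles ℤ S}
    (hc : Submodule.Quotient.mk c = f) {h : C(S, S)}
    (hh : SingularH1.map (R := ℝ) h (SingularH1.toReal f) = SingularH1.toReal f) {γ γ' : C(I, S)}
    (h0 : γ 0 = γ' 0) (h1 : γ 1 = γ' 1) :
    c.1 (h.comp γ) - c.1 (h.comp γ') = c.1 γ - c.1 γ' := by
  subst hc
  have h2 : (Submodule.Quotient.mk (SingularH1.cocycleMap h (SingularH1.cocycleToReal c)) :
      SingularH1 ℝ S) = Submodule.Quotient.mk (SingularH1.cocycleToReal c) := hh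
  rw [Submodule.Quotient.eq] at h2
  obtain ⟨b, hb⟩ := h2
  -- The change of the cocycle under `h` is a real coboundary, so it depends only on the endpoints.
  have key : ∀ γ : C(I, S), (b (γ 1) - b (γ 0) : ℝ) = (c.1 (h.comp γ) : ℝ) - (c.1 γ : ℝ) :=
    fun γ => congrFun hb γ
  have e1 := key γ
  have e2 := key γ'
  rw [h0, h1] at e1
  have : ((c.1 (h.comp γ) - c.1 (h.comp γ') : ℤ) : ℝ) = ((c.1 γ - c.1 γ' : ℤ) : ℝ) := by
    push_cast; linarith
  exact_mod_cast this

/-- The lifting criterion for `h ∘ p`: since `h` fixes the classes `f i`, it preserves the condition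
for a loop to lift to a closed path. -/
theorem exists_lift [PathConnectedSpace E] [LocallyPathConnectedSpace E]
    (hp : IsCoverDefinedBy f p) {h : C(S, S)}
    (hh : ∀ i, SingularH1.map (R := ℝ) h (SingularH1.toReal (f i)) = SingularH1.toReal (f i))
    {x y : E} (hxy : p y = h (p x)) : ∃ F : C(E, E), F x = y ∧ ∀ z, p (F z) = h (p z) := by
  choose c hc using fun i => Submodule.Quotient.mk_surjective _ (f i)
  have hlift := hp.isCoveringMap.isLocalHomeomorph.existsUnique_continuousMap_lifts (h.comp p) x y
    hxy ?_ ?_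
  · obtain ⟨F, ⟨hF, hF'⟩, -⟩ := hlift
    exact ⟨F, hF, fun z => congrFun hF' z⟩
  · intro γ hγ
    obtain ⟨Γ, h1, h2⟩ := hp.isCoveringMap.exists_path_lifts ((h.comp p).comp γ) y
      (by rw [ContinuousMap.comp_apply, hγ, hxy]; rfl)
    exact ⟨Γ, h2, h1⟩
  · intro γ γ' Γ Γ' h0 h0' H0 H0' hΓ hΓ' h1
    have e : p.comp Γ = h.comp (p.comp γ) := ContinuousMap.ext fun t => congrFun hΓ t
    have e' : p.comp Γ' = h.comp (p.comp γ') := ContinuousMap.ext fun t => congrFun hΓ' t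
    have hend : p (Γ 1) = p (Γ' 1) := by
      have a := DFunLike.congr_fun e 1
      have b := DFunLike.congr_fun e' 1
      simp only [ContinuousMap.comp_apply] at a b
      rw [a, b, h1]
    rw [hp.eq_iff_of_lifts hc (H0.trans H0'.symm) hend]
    intro i
    have h2 := (hp.eq_iff_of_lifts hc (h0.trans h0'.symm) (congrArg p h1)).1 h1 i
    have h3 := cocycle_comp_sub (hc i) (hh i) (γ := p.comp γ) (γ' := p.comp γ')
      (congrArg p (h0.trans h0'.symm)) (congrArg p h1)
    rw [e, e']
    linarith

theorem eq_id_of_fixed (hp : IsCoverDefinedBy f p) {F : E → E} (hF : Continuous F)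
    (hpF : ∀ z, p (F z) = p z) {x : E} (hx : F x = x) (z : E) : F z = z := by
  have := hp.connected
  exact congrFun (hp.isCoveringMap.eq_of_comp_eq hF continuous_id (funext hpF) x hx) z

/-- The lifts of `h` and of its inverse compose to lifts of the identity with a fixed point, and
such lifts are the identity. -/
theorem exists_homeomorph_lift [PathConnectedSpace E] [LocallyPathConnectedSpace E]
    (hp : IsCoverDefinedBy f p) {h : S ≃ₜ S}
    (hh : ∀ i, SingularH1.map (R := ℝ) (h : C(S, S)) (SingularH1.toReal (f i)) = SingularH1.toReal (f i))
    (hh' : ∀ i, SingularH1.map (R := ℝ) (h.symm : C(S, S)) (SingularH1.toReal (f i)) =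
      SingularH1.toReal (f i))
    {x y : E} (hxy : p y = h (p x)) : ∃ F : E ≃ₜ E, F x = y ∧ ∀ z, p (F z) = h (p z) := by
  obtain ⟨F, hF, hpF⟩ := hp.exists_lift hh hxy
  obtain ⟨F', hF', hpF'⟩ := hp.exists_lift hh' (x := y) (y := x) (by rw [hxy]; simp)
  refine ⟨⟨⟨F, F', ?_, ?_⟩, F.continuous, F'.continuous⟩, hF, hpF⟩
  · refine hp.eq_id_of_fixed (F := fun z => F' (F z)) (by fun_prop) (fun z => ?_) (x := x)
      (by rw [hF, hF'])
    rw [hpF', hpF]; simp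
  · refine hp.eq_id_of_fixed (F := fun z => F (F' z)) (by fun_prop) (fun z => ?_) (x := y)
      (by rw [hF', hF])
    rw [hpF, hpF']; simp

theorem t2Space [T2Space S] (hp : IsCoverDefinedBy f p) : T2Space E := by
  refine ⟨fun x y hxy => ?_⟩
  by_cases h : p x = p y
  · exact hp.isCoveringMap.isSeparatedMap x y h hxy
  · obtain ⟨u, v, hu, hv, hxu, hyv, huv⟩ := t2_separation h
    exact ⟨p ⁻¹' u, p ⁻¹' v, hu.preimage p.continuous, hv.preimage p.continuous, hxu, hyv,
      huv.preimage p⟩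

theorem surjective [PathConnectedSpace S] (hp : IsCoverDefinedBy f p) :
    Function.Surjective p := by
  intro s
  have := hp.connected
  obtain ⟨e⟩ := (inferInstance : Nonempty E)
  obtain ⟨Γ, h1, h2⟩ := hp.isCoveringMap.exists_path_lifts
    (PathConnectedSpace.somePath (p e) s).toContinuousMap e (by simp)
  exact ⟨Γ 1, by simpa using congrFun h1 1⟩

end IsCoverDefinedBy

/-! ### Local path-connectedness -/

namespace TranslationSurface

variable {S : Type*} [TopologicalSpace S]

theorem exists_openPartialHomeomorph (X : TranslationSurface S) (x : S) :
    ∃ e : OpenPartialHomeomorph S ℂ, x ∈ e.source := by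
  by_cases hx : x ∈ X.sing
  · obtain ⟨k, hk, w, hxw, -⟩ := X.cone x hx
    exact ⟨w, hxw⟩
  · obtain ⟨φ, -, hxφ⟩ := X.exists_chart x hx
    exact ⟨φ, hxφ⟩

theorem locallyPathConnectedSpace (X : TranslationSurface S) : LocallyPathConnectedSpace S := by
  choose e he using X.exists_openPartialHomeomorph
  let _ : ChartedSpace ℂ S := ⟨range e, e, he, fun x => ⟨x, rfl⟩⟩
  exact ChartedSpace.locallyPathConnectedSpace ℂ S

end TranslationSurface

/-! ### Lifting and descending affine automorphisms; the deck group -/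

namespace TranslationSurface

variable {S E : Type*} [TopologicalSpace S] [TopologicalSpace E] {X : TranslationSurface S}
  {p : C(E, S)} {hloc : IsLocalHomeomorph p}

/-- A lift of an affine automorphism is affine, with the same linear part. -/
theorem IsAffine.of_lift {h : S ≃ₜ S} {A : SL(2, ℝ)} (hh : X.IsAffine h A) {F : E ≃ₜ E}
    (hF : ∀ z, p (F z) = h (p z)) : (X.pullback p hloc).IsAffine F A := by
  refine ⟨fun x => ?_, ?_⟩
  · change p (F x) ∈ X.sing ↔ p x ∈ X.sing
    rw [hF]; exact hh.1 _
  · intro e he e' he' x hx hx'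
    have hxs : p x ∉ X.sing := fun hs => he.1.le_bot ⟨hx, hs⟩
    obtain ⟨φ, hφ, hxφ⟩ := X.exists_chart (p x) hxs
    obtain ⟨ψ, hψ, hxψ⟩ := X.exists_chart (h (p x)) (fun hs => hxs ((hh.1 _).1 hs))
    obtain ⟨c, hc⟩ := he.2 φ hφ x hx hxφ
    obtain ⟨c', hc'⟩ := he'.2 ψ hψ (F x) hx' (by rwa [hF])
    obtain ⟨d, hd⟩ := hh.2 φ hφ ψ hψ (p x) hxφ hxψ
    refine ⟨planeAct A c + d - c', ?_⟩
    filter_upwards [hc, F.continuous.continuousAt.eventually hc',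
      p.continuous.continuousAt.eventually hd] with y h1 h2 h3
    rw [hF, h3, h1, planeAct_add] at h2
    linear_combination -h2

/-- An affine automorphism of the cover that permutes the fibres descends. -/
theorem IsAffine.of_descends (hsurj : Function.Surjective p) {F : E ≃ₜ E} {A : SL(2, ℝ)}
    (hF : (X.pullback p hloc).IsAffine F A) {h : S ≃ₜ S} (hh : ∀ z, p (F z) = h (p z)) :
    X.IsAffine h A := by
  constructor
  · intro s
    obtain ⟨x, rfl⟩ := hsurj s
    rw [← hh]
    exact hF.1 x
  · intro φ hφ ψ hψ s hs hs'
    obtain ⟨x, rfl⟩ := hsurj s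
    have hxs : x ∉ (X.pullback p hloc).sing := fun h => (X.disjoint_sing φ hφ).le_bot ⟨hs, h⟩
    obtain ⟨e, he, hxe⟩ := (X.pullback p hloc).exists_chart x hxs
    obtain ⟨e', he', hxe'⟩ := (X.pullback p hloc).exists_chart (F x)
      (fun h => hxs ((hF.1 x).1 h))
    obtain ⟨c, hc⟩ := he.2 φ hφ x hxe hs
    obtain ⟨c', hc'⟩ := he'.2 ψ hψ (F x) hxe' (by rwa [hh])
    obtain ⟨d, hd⟩ := hF.2 e he e' he' x hxe hxe'
    refine ⟨d + c' - planeAct A c, ?_⟩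
    rw [← hloc.map_nhds_eq x]
    change ∀ᶠ y in 𝓝 x, ψ (h (p y)) = planeAct A (φ (p y)) + (d + c' - planeAct A c)
    filter_upwards [hc, F.continuous.continuousAt.eventually hc', hd] with y h1 h2 h3
    rw [← hh, h2, h3, h1, planeAct_add]
    ring

variable (X p hloc) in
/-- The deck transformations of `p`, as a group of affine automorphisms of the cover. -/
def deckGroup : Subgroup (X.pullback p hloc).affineGroup where
  carrier := {g | g.1.2 = 1 ∧ ∀ z, p (g.1.1 z) = p z}
  one_mem' := ⟨rfl, fun _ => rfl⟩
  mul_mem' := by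
    rintro a b ⟨ha, ha'⟩ ⟨hb, hb'⟩
    refine ⟨?_, fun z => (ha' _).trans (hb' z)⟩
    change a.1.2 * b.1.2 = 1
    rw [ha, hb, one_mul]
  inv_mem' := by
    rintro a ⟨ha, ha'⟩
    refine ⟨?_, fun z => ?_⟩
    · change a.1.2⁻¹ = 1
      rw [ha, inv_one]
    · change p (a.1.1.symm z) = p z
      rw [← ha', a.1.1.apply_symm_apply]

theorem affineGroup_ext {Y : TranslationSurface S} {g h : Y.affineGroup}
    (h1 : ∀ z, g.1.1 z = h.1.1 z) (h2 : g.1.2 = h.1.2) : g = h :=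
  Subtype.ext (Prod.ext (Homeomorph.ext h1) h2)

theorem deckGroup_le_ker : X.deckGroup p hloc ≤ (X.pullback p hloc).derivative.ker :=
  fun _ hg => hg.1

variable {ι : Type*} {f : ι → SingularH1 ℤ S}

theorem exists_deckGroup_apply_eq [PathConnectedSpace E] [LocallyPathConnectedSpace E]
    (hp : IsCoverDefinedBy f p) {x y : E} (hxy : p y = p x) :
    ∃ g ∈ X.deckGroup p hloc, g.1.1 x = y := by
  obtain ⟨F, hF, hpF⟩ := hp.exists_homeomorph_lift (h := Homeomorph.refl S)
    (fun i => LinearMap.congr_fun SingularH1.map_id _)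
    (fun i => LinearMap.congr_fun SingularH1.map_id _) hxy
  have haff : (X.pullback p hloc).IsAffine F 1 := IsAffine.of_lift IsAffine.one hpF
  exact ⟨⟨(F, 1), haff⟩, ⟨rfl, hpF⟩, hF⟩

theorem deckGroup_eq_one_of_fixed (hp : IsCoverDefinedBy f p)
    {g : (X.pullback p hloc).affineGroup} (hg : g ∈ X.deckGroup p hloc) {x : E}
    (hx : g.1.1 x = x) : g = 1 :=
  affineGroup_ext (hp.eq_id_of_fixed g.1.1.continuous hg.2 hx) hg.1

/-- The deck group of the cover defined by a `d`-tuple embeds in `ℤ ^ d`. -/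
theorem exists_deckGroup_embedding [PathConnectedSpace E] {d : ℕ} {f : Fin d → SingularH1 ℤ S}
    (hp : IsCoverDefinedBy f p) :
    ∃ Φ : X.deckGroup p hloc →* Multiplicative (Fin d → ℤ), Function.Injective Φ := by
  choose c hc using fun i => Submodule.Quotient.mk_surjective _ (f i)
  obtain ⟨x⟩ := (inferInstance : Nonempty E)
  let γ : X.deckGroup p hloc → C(I, E) := fun g =>
    (PathConnectedSpace.somePath x (g.1.1.1 x)).toContinuousMap
  have h0 : ∀ g, γ g 0 = x := fun g => (PathConnectedSpace.somePath x (g.1.1.1 x)).source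
  have h1 : ∀ g, γ g 1 = g.1.1.1 x := fun g => (PathConnectedSpace.somePath x (g.1.1.1 x)).target
  -- `Φ g` is the tuple of cocycle values along the projection of a path from `x` to `g x`. For a
  -- product, the path to `a x` is followed by the `a`-translate of the path to `b x`, which has the
  -- same projection as the latter path.
  refine ⟨MonoidHom.mk' (fun g => Multiplicative.ofAdd fun i => (c i).1 (p.comp (γ g))) ?_, ?_⟩
  · intro a b
    let a' : C(E, E) := ⟨a.1.1.1, a.1.1.1.continuous⟩
    obtain ⟨δ, hδ0, hδ1, hδ⟩ := exists_concat (γ a) (a'.comp (γ b)) (by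
      rw [h1, ContinuousMap.comp_apply, h0]; rfl)
    have hpa : p.comp (a'.comp (γ b)) = p.comp (γ b) :=
      ContinuousMap.ext fun t => a.2.2 _
    have hend : γ (a * b) 1 = δ 1 := by
      rw [h1, hδ1, ContinuousMap.comp_apply, h1]; rfl
    have key := (hp.eq_iff_of_lifts hc ((h0 (a * b)).trans (hδ0.trans (h0 a)).symm)
      (congrArg p hend)).1 hend
    rw [← ofAdd_add]
    congr 1
    funext i
    rw [key i, hδ, hpa, Pi.add_apply]
  · intro a b hab
    have hval : ∀ i, (c i).1 (p.comp (γ a)) = (c i).1 (p.comp (γ b)) := fun i =>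
      congrFun (Multiplicative.ofAdd.injective hab) i
    have hend := (hp.eq_iff_of_lifts hc ((h0 a).trans (h0 b).symm) (by
      rw [h1, h1]; exact (a.2.2 x).trans (b.2.2 x).symm)).2 hval
    rw [h1, h1] at hend
    have hfix : (b.1⁻¹ * a.1).1.1 x = x := by
      change b.1.1.1.symm (a.1.1.1 x) = x
      rw [hend, Homeomorph.symm_apply_apply]
    have := deckGroup_eq_one_of_fixed hp
      ((X.deckGroup p hloc).mul_mem ((X.deckGroup p hloc).inv_mem b.2) a.2) hfix
    exact Subtype.ext (inv_mul_eq_one.1 this).symm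

/-- The deck group has finite index in the group of translations of the cover. -/
theorem deckGroup_relIndex_ne_zero [CompactSpace S] [T2Space S] [PathConnectedSpace E]
    [LocallyPathConnectedSpace E] (hp : IsCoverDefinedBy f p)
    {x : E} (hx : x ∈ (X.pullback p hloc).sing) :
    (X.deckGroup p hloc).relIndex (X.pullback p hloc).derivative.ker ≠ 0 := by
  have := hp.t2Space
  set T := (X.pullback p hloc).derivative.ker
  set D := X.deckGroup p hloc
  have haff : ∀ t : T, (X.pullback p hloc).IsAffine t.1.1.1 1 := fun t => by
    have h1 : (X.pullback p hloc).IsAffine t.1.1.1 t.1.1.2 := t.1.2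
    exact (show t.1.1.2 = 1 from t.2) ▸ h1
  have hstab : Finite {t : T // t.1.1.1 x = x} := by
    have := (finite_setOf_isAffine_one_fixed hx).to_subtype
    refine Finite.of_injective (β := {t : E ≃ₜ E | (X.pullback p hloc).IsAffine t 1 ∧ t x = x})
      (fun t => ⟨t.1.1.1.1, haff t.1, t.2⟩) fun s t hst => ?_
    refine Subtype.ext (Subtype.ext (Subtype.ext (Prod.ext (congrArg Subtype.val hst) ?_)))
    exact (show s.1.1.1.2 = 1 from s.1.2).trans (show t.1.1.1.2 = 1 from t.1.2).symm
  have hsing := X.finite_sing.to_subtype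
  classical
  -- Modulo the deck group, a translation `t` is determined, up to the finite stabilizer of `x`, by
  -- the singularity of the base below `t⁻¹ x`; `rep` chooses one translation for each singularity
  -- that occurs, and the value `1` elsewhere is never needed.
  let rep : X.sing → T := fun s =>
    if h : ∃ t : T, p ((t⁻¹).1.1.1 x) = s then h.choose else 1
  have hsurj : Function.Surjective (fun q : {t : T // t.1.1.1 x = x} × X.sing =>
      (QuotientGroup.mk (q.1.1 * rep q.2) : T ⧸ D.subgroupOf T)) := by
    intro q
    obtain ⟨t, rfl⟩ := QuotientGroup.mk_surjective q
    have hs : p ((t⁻¹).1.1.1 x) ∈ X.sing := ((haff t⁻¹).1 x).2 hx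
    have hex : ∃ t' : T, p ((t'⁻¹).1.1.1 x) = p ((t⁻¹).1.1.1 x) := ⟨t, rfl⟩
    have hrep : p (((rep ⟨_, hs⟩)⁻¹).1.1.1 x) = p ((t⁻¹).1.1.1 x) := by
      simp only [rep]
      rw [dif_pos hex]
      exact hex.choose_spec
    obtain ⟨g, hg, hgx⟩ := exists_deckGroup_apply_eq (X := X) (hloc := hloc) hp hrep
    let g' : T := ⟨g, deckGroup_le_ker hg⟩
    have hg' : g' ∈ D.subgroupOf T := hg
    refine ⟨⟨⟨t * g'⁻¹ * (rep ⟨_, hs⟩)⁻¹, ?_⟩, ⟨_, hs⟩⟩, ?_⟩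
    · change t.1.1.1 (g.1.1.symm (((rep ⟨_, hs⟩)⁻¹).1.1.1 x)) = x
      rw [← hgx, Homeomorph.symm_apply_apply]
      exact t.1.1.1.apply_symm_apply x
    · simp only [inv_mul_cancel_right]
      rw [QuotientGroup.eq]
      simpa using hg'
  have := Finite.of_surjective _ hsurj
  have : (D.subgroupOf T).FiniteIndex := Subgroup.finiteIndex_of_finite_quotient
  exact this.index_ne_zero

/-- An affine automorphism of the cover that normalizes the deck group has its linear part in the
Veech group of the base. -/
theorem derivative_mem_veechGroup [PathConnectedSpace E] [LocallyPathConnectedSpace E]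
    (hp : IsCoverDefinedBy f p) (hsurj : Function.Surjective p)
    {g : (X.pullback p hloc).affineGroup}
    (h1 : ∀ x ∈ X.deckGroup p hloc, g * x * g⁻¹ ∈ X.deckGroup p hloc)
    (h2 : ∀ x ∈ X.deckGroup p hloc, g⁻¹ * x * g⁻¹⁻¹ ∈ X.deckGroup p hloc) :
    (X.pullback p hloc).derivative g ∈ X.veechGroup := by
  -- The deck group is transitive on fibres, so an automorphism that conjugates it into itself maps
  -- fibres into fibres.
  have hfib : ∀ k : (X.pullback p hloc).affineGroup,
      (∀ x ∈ X.deckGroup p hloc, k * x * k⁻¹ ∈ X.deckGroup p hloc) →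
      ∀ x y, p x = p y → p (k.1.1 x) = p (k.1.1 y) := by
    intro k hk x y hxy
    obtain ⟨δ, hδ, rfl⟩ := exists_deckGroup_apply_eq (X := X) (hloc := hloc) hp hxy
    have h3 := (hk δ hδ).2 (k.1.1 y)
    change p (k.1.1 (δ.1.1 (k.1.1.symm (k.1.1 y)))) = _ at h3
    rwa [Homeomorph.symm_apply_apply] at h3
  have hq : IsQuotientMap p := hp.isCoveringMap.isQuotientMap hsurj
  let F : C(E, S) := p.comp ⟨g.1.1, g.1.1.continuous⟩
  let F' : C(E, S) := p.comp ⟨g.1.1.symm, g.1.1.symm.continuous⟩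
  let h : C(S, S) := hq.lift F fun x y hxy => hfib g h1 x y hxy
  let h' : C(S, S) := hq.lift F' fun x y hxy => hfib g⁻¹ h2 x y hxy
  have hh : ∀ x, h (p x) = p (g.1.1 x) := fun x =>
    DFunLike.congr_fun (hq.lift_comp F fun x y hxy => hfib g h1 x y hxy) x
  have hh' : ∀ x, h' (p x) = p (g.1.1.symm x) := fun x =>
    DFunLike.congr_fun (hq.lift_comp F' fun x y hxy => hfib g⁻¹ h2 x y hxy) x
  let H : S ≃ₜ S := ⟨⟨h, h', fun s => by
    obtain ⟨x, rfl⟩ := hsurj s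
    rw [hh, hh', Homeomorph.symm_apply_apply], fun s => by
    obtain ⟨x, rfl⟩ := hsurj s
    rw [hh', hh, Homeomorph.apply_symm_apply]⟩, h.continuous, h'.continuous⟩
  have hgaff : (X.pullback p hloc).IsAffine g.1.1 g.1.2 := g.2
  have haff : X.IsAffine H g.1.2 := hgaff.of_descends hsurj fun z => (hh z).symm
  exact ⟨⟨(H, g.1.2), haff⟩, rfl⟩

/-- A subgroup of finite index of the Veech group of the cover is contained in the Veech group of
the base. -/
theorem exists_finiteIndex_le_veechGroup [CompactSpace S] [T2Space S]
    [PathConnectedSpace S] [PathConnectedSpace E] [LocallyPathConnectedSpace E] {d : ℕ}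
    {f : Fin d → SingularH1 ℤ S} (hp : IsCoverDefinedBy f p) (hsing : X.sing.Nonempty) :
    ∃ V : Subgroup SL(2, ℝ), V ≤ (X.pullback p hloc).veechGroup ∧
      V.relIndex (X.pullback p hloc).veechGroup ≠ 0 ∧ V ≤ X.veechGroup := by
  have hsurj := hp.surjective
  obtain ⟨s, hs⟩ := hsing
  obtain ⟨x, rfl⟩ := hsurj s
  obtain ⟨Φ, hΦ⟩ := exists_deckGroup_embedding (X := X) (hloc := hloc) hp
  obtain ⟨N, hN, hconj⟩ := exists_finiteIndex_normalizing
    (deckGroup_le_ker (X := X) (p := p) (hloc := hloc))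
    (deckGroup_relIndex_ne_zero hp (show x ∈ (X.pullback p hloc).sing from hs))
    (commute_of_injective_to_int Φ hΦ) (fg_of_injective_to_int Φ hΦ)
  refine ⟨N.map (X.pullback p hloc).derivative, ?_, ?_, ?_⟩
  · rintro _ ⟨g, -, rfl⟩
    exact ⟨g, rfl⟩
  · rw [veechGroup, MonoidHom.range_eq_map, Subgroup.relIndex_map_map, top_sup_eq,
      Subgroup.relIndex_top_right]
    have : (N ⊔ (X.pullback p hloc).derivative.ker).FiniteIndex :=
      Subgroup.finiteIndex_of_le le_sup_left
    exact this.index_ne_zero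
  · rintro _ ⟨g, hg, rfl⟩
    exact derivative_mem_veechGroup hp hsurj (hconj g hg) (hconj g⁻¹ (N.inv_mem hg))

end TranslationSurface

/-! ### Kernels of the action on cohomology, and the conclusion -/

namespace TranslationSurface

variable {S : Type*} [TopologicalSpace S] {X : TranslationSurface S}

theorem mem_repKer_iff {G : Subgroup X.affineGroup} {F : Subrepresentation (rep G)} {g : G} :
    g ∈ repKer F ↔ ∀ v ∈ F.toSubmodule, rep G g v = v := by
  rw [repKer, MonoidHom.mem_ker]
  constructor
  · intro h v hv
    exact congrArg Subtype.val (LinearMap.congr_fun h ⟨v, hv⟩)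
  · intro h
    ext v
    exact h v.1 v.2

/-- The kernel of the action on a sum is the intersection of the kernels. -/
theorem repKer_sumSubrep {G : Subgroup X.affineGroup} {ι : Type*}
    (F : ι → Subrepresentation (rep G)) : repKer (sumSubrep F) = ⨅ j, repKer (F j) := by
  ext g
  simp only [Subgroup.mem_iInf, mem_repKer_iff]
  constructor
  · intro h j v hv
    exact h v (Submodule.mem_iSup_of_mem j hv)
  · intro h
    have hle : (⨆ j, (F j).toSubmodule) ≤ LinearMap.eqLocus (rep G g) LinearMap.id :=
      iSup_le fun j v hv => h j v hv
    exact fun v hv => hle hv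

instance repKer_normal {G : Subgroup X.affineGroup} (F : Subrepresentation (rep G)) :
    (repKer F).Normal := MonoidHom.normal_ker _

/-- The affine automorphisms that act trivially on the classes defining a cover lift to it. -/
theorem map_repKer_le_veechGroup {E : Type*} [TopologicalSpace E] [PathConnectedSpace S]
    [PathConnectedSpace E] [LocallyPathConnectedSpace E] {p : C(E, S)}
    {hloc : IsLocalHomeomorph p} {ι : Type*} {f : ι → SingularH1 ℤ S}
    (hp : IsCoverDefinedBy f p) {G : Subgroup X.affineGroup} {F : Subrepresentation (rep G)}
    (hfF : ∀ i, SingularH1.toReal (f i) ∈ F.toSubmodule) :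
    (repKer F).map (linearPart G) ≤ (X.pullback p hloc).veechGroup := by
  rintro _ ⟨g, hg, rfl⟩
  have h1 := fun i => mem_repKer_iff.1 hg _ (hfF i)
  have h2 := fun i => mem_repKer_iff.1 ((repKer F).inv_mem hg) _ (hfF i)
  obtain ⟨x⟩ := (inferInstance : Nonempty E)
  obtain ⟨y, hy⟩ := hp.surjective (g.1.1.1 (p x))
  obtain ⟨H, -, hH⟩ := hp.exists_homeomorph_lift (h := g.1.1.1) h2 h1 hy
  have haff : X.IsAffine g.1.1.1 g.1.1.2 := g.1.2
  exact ⟨⟨(H, g.1.1.2), haff.of_lift hH⟩, rfl⟩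

end TranslationSurface

open TranslationSurface in
/-- The limit sets of the linear parts of the kernel and of the Veech group of the cover both
agree with that of the original group, and all three groups are discrete. -/
theorem limitSet_eq_and_discrete {S : Type*} [TopologicalSpace S] [CompactSpace S] [T2Space S]
    [ConnectedSpace S] (X : TranslationSurface S) (hsing : X.sing.Nonempty)
    (G : Subgroup X.affineGroup) [G.FiniteIndex] (hG : ∀ g : G, IsOfFinOrder g → g = 1)
    {n : ℕ} (F : Fin n → Subrepresentation (rep G)) {d : ℕ} (f : Fin d → SingularH1 ℤ S)
    (hfF : ∀ i, SingularH1.toReal (f i) ∈ (sumSubrep F).toSubmodule)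
    {E : Type*} [TopologicalSpace E] (p : C(E, S)) (hp : IsCoverDefinedBy f p)
    (hK : ∀ j, repKer (F j) ≠ ⊥) (hdisc : DiscreteTopology (linearPart G).range)
    (hinf : (limitSet (linearPart G).range).Infinite) :
    (DiscreteTopology ((repKer (sumSubrep F)).map (linearPart G)) ∧
      limitSet ((repKer (sumSubrep F)).map (linearPart G)) = limitSet (linearPart G).range) ∧
    (DiscreteTopology (X.pullback p hp.isCoveringMap.isLocalHomeomorph).veechGroup ∧
      limitSet (X.pullback p hp.isCoveringMap.isLocalHomeomorph).veechGroup =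
        limitSet (linearPart G).range) := by
  have := X.locallyPathConnectedSpace
  have := hp.connected
  have : LocallyPathConnectedSpace E :=
    (X.pullback p hp.isCoveringMap.isLocalHomeomorph).locallyPathConnectedSpace
  have : PathConnectedSpace S := pathConnectedSpace_iff_connectedSpace.2 inferInstance
  have : PathConnectedSpace E := pathConnectedSpace_iff_connectedSpace.2 inferInstance
  have hinj := linearPart_injective hsing hG
  have hKne : repKer (sumSubrep F) ≠ ⊥ := by
    rw [repKer_sumSubrep]
    exact Fuchsian.iInf_ne_bot_of_normal hinj hdisc hG hinf _ hK
  have hKlim := Fuchsian.limitSet_map_eq_of_normal hinj hdisc hG hinf hKne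
  have hKle : (repKer (sumSubrep F)).map (linearPart G) ≤ (linearPart G).range := by
    rintro _ ⟨g, -, rfl⟩
    exact ⟨g, rfl⟩
  have hKV := map_repKer_le_veechGroup (hloc := hp.isCoveringMap.isLocalHomeomorph) hp hfF
  have hΓV : (linearPart G).range ≤ X.veechGroup := by
    rintro _ ⟨g, rfl⟩
    exact ⟨g.1, rfl⟩
  have hΓfin : (linearPart G).range.relIndex X.veechGroup ≠ 0 := by
    have h1 : (linearPart G).range = G.map X.derivative := by
      rw [linearPart, MonoidHom.range_comp, Subgroup.range_subtype]
    rw [h1, veechGroup, MonoidHom.range_eq_map, Subgroup.relIndex_map_map, top_sup_eq,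
      Subgroup.relIndex_top_right]
    have : (G ⊔ X.derivative.ker).FiniteIndex := Subgroup.finiteIndex_of_le le_sup_left
    exact this.index_ne_zero
  obtain ⟨V, hVE, hVfin, hVX⟩ := exists_finiteIndex_le_veechGroup
    (hloc := hp.isCoveringMap.isLocalHomeomorph) hp hsing
  have hsub : ∀ {H K : Subgroup SL(2, ℝ)}, H ≤ K → DiscreteTopology K → DiscreteTopology H :=
    fun h _ => DiscreteTopology.of_subset (s := (_ : Set SL(2, ℝ))) inferInstance h
  have hsup : ∀ {H K : Subgroup SL(2, ℝ)}, H ≤ K → H.relIndex K ≠ 0 → DiscreteTopology H →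
      DiscreteTopology K := fun {H K} h hfin hH => by
    have : Subgroup.IsFiniteRelIndex H K := ⟨hfin⟩
    exact (Subgroup.discreteTopology_iff_of_isFiniteRelIndex h).1 hH
  -- Discreteness goes up from `Γ` to the Veech group of `X`, down to `V`, and up to the Veech group
  -- of the cover.
  refine ⟨⟨hsub hKle hdisc, hKlim⟩, hsup hVE hVfin (hsub hVX (hsup hΓV hΓfin hdisc)), ?_⟩
  refine Subset.antisymm ?_ ?_
  · rw [← Fuchsian.limitSet_eq_of_relIndex_ne_zero hVE hVfin,
      Fuchsian.limitSet_eq_of_relIndex_ne_zero hΓV hΓfin]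
    exact Fuchsian.limitSet_mono hVX
  · rw [← hKlim]
    exact Fuchsian.limitSet_mono hKV

end

theorem theorem1
    -- a compact connected translation surface `X`, with underlying space `S`
    {S : Type*} [TopologicalSpace S] [CompactSpace S] [T2Space S] [ConnectedSpace S]
    (X : TranslationSurface S) (hsing : X.sing.Nonempty)
    -- a torsion-free group of affine automorphisms, of finite index
    (G : Subgroup X.affineGroup) [G.FiniteIndex] (hG : ∀ g : G, IsOfFinOrder g → g = 1)
    -- integer invariant subspaces in direct sum
    {n : ℕ} (F : Fin n → Subrepresentation (TranslationSurface.rep G))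
    (hFint : ∀ j, SingularH1.IsInteger (F j).toSubmodule)
    (hFsum : iSupIndep fun j => (F j).toSubmodule)
    -- the cover defined by a tuple of integer classes in their sum
    {d : ℕ} (f : Fin d → SingularH1 ℤ S) (hf : LinearIndependent ℤ f)
    (hfF : ∀ i, SingularH1.toReal (f i) ∈ (TranslationSurface.sumSubrep F).toSubmodule)
    {E : Type*} [TopologicalSpace E] (p : C(E, S)) (hp : IsCoverDefinedBy f p)
    -- all the kernels are non-trivial
    (hK : ∀ j, TranslationSurface.repKer (F j) ≠ ⊥) :
    TranslationSurface.repKer (TranslationSurface.sumSubrep F)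
        = ⨅ j, TranslationSurface.repKer (F j) ∧
    (IsFirstKind (TranslationSurface.linearPart G).range →
      IsFirstKind ((TranslationSurface.repKer (TranslationSurface.sumSubrep F)).map
        (TranslationSurface.linearPart G)) ∧
      IsFirstKind (X.pullback p hp.isCoveringMap.isLocalHomeomorph).veechGroup) ∧
    (IsSecondKind (TranslationSurface.linearPart G).range →
      IsSecondKind ((TranslationSurface.repKer (TranslationSurface.sumSubrep F)).map
        (TranslationSurface.linearPart G)) ∧
      IsSecondKind (X.pullback p hp.isCoveringMap.isLocalHomeomorph).veechGroup) := by
  refine ⟨TranslationSurface.repKer_sumSubrep F, ?_, ?_⟩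
  · rintro ⟨hdisc, hlim⟩
    obtain ⟨⟨h1, h2⟩, h3, h4⟩ := limitSet_eq_and_discrete X hsing G hG F f hfF p hp hK hdisc
      (hlim ▸ Set.infinite_univ)
    exact ⟨⟨h1, h2.trans hlim⟩, h3, h4.trans hlim⟩
  · rintro ⟨hdisc, hinf, hne⟩
    obtain ⟨⟨h1, h2⟩, h3, h4⟩ := limitSet_eq_and_discrete X hsing G hG F f hfF p hp hK hdisc hinf
    exact ⟨⟨h1, h2 ▸ hinf, h2 ▸ hne⟩, h3, h4 ▸ hinf, h4 ▸ hne⟩
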